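/- Let $\mathbb F$ be a field of characteristic different from $2$ and $3$, let $V$ be a $3$-dimensional $\mathbb F$-vector space with dual $V^*$, and fix a nonzero alternating trilinear form $\det$ on $V$; let $\det$ also denote the alternating trilinear form on $V^*$ with $\det(f_1\wedge f_2\wedge f_3)\det(v_1\wedge v_2\wedge v_3)=\det\bigl(f_i(v_j)\bigr)$, and use these forms to identify $\bigwedge^2V=V^*$ via $u_1\wedge u_2=\det(u_1\wedge u_2\wedge\,\cdot\,)$, and likewise $\bigwedge^2V^*=V$. Let $\mathcal L$ be a Lie algebra over $\mathbb F$ (of any dimension) with an injective Lie algebra homomorphism $\iota:\mathfrak{sl}(V)\to\mathcal L$, such that, as a module for $\mathfrak{sl}(V)$ (acting through $\iota$), \[ \mathcal L=(\mathfrak{sl}(V)\otimes A)\oplus(V\otimes B)\oplus(V^*\otimes C)\oplus\mathfrak s \] for vector spaces $A,B,C$, where $\mathfrak s$ is the subalgebra of the elements of $\mathcal L$ annihilated by $\mathfrak{sl}(V)$, and where $\mathfrak{sl}(V)$ acts only on the first tensor factors, in the adjoint, natural and dual way. Then there is $1\in A$ with $\iota(x)=x\otimes 1$ for all $x\in\mathfrak{sl}(V)$,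 and the bracket of $\mathcal L$ has the form \[ \begin{aligned} [x\otimes a,y\otimes a']&=[x,y]\otimes\tfrac12 a\circ a'+x\circ y\otimes\tfrac12[a,a']+(x|y)D_{a,a'},\\ [x\otimes a,u\otimes b]&=xu\otimes ab,\qquad [v^*\otimes c,x\otimes a]=v^*x\otimes ca,\\ [u\otimes b,v^*\otimes c]&=\bigl(uv^*-\tfrac13(v^*u)I\bigr)\otimes T(b,c)+\tfrac13(v^*u)D_{b,c},\\ [u_1\otimes b_1,u_2\otimes b_2]&=(u_1\wedge u_2)\otimes(b_1\times b_2),\qquad [v_1^*\otimes c_1,v_2^*\otimes c_2]=(v_1^*\wedge v_2^*)\otimes(c_1\times c_2),\\ [d,x\otimes a]&=x\otimes da,\qquad [d,u\otimes b]=u\otimes db,\qquad [d,v^*\otimes c]=v^*\otimes dc \end{aligned} \] (with $x,y\in\mathfrak{sl}(V)$, $u,u_i\in V$, $v^*,v_i^*\in V^*$, $d\in\mathfrak s$, $a,a'\in A$, $b,b_i\in B$, $c,c_i\in C$, where $x\circ y=xy+yx-\frac23\operatorname{tr}(xy)I$ and $(x|y)=\frac13\operatorname{tr}(xy)$) for bilinear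 maps $a\circ a'\in A$ (commutative), $[a,a']\in A$ (anticommutative), $D_{a,a'}\in\mathfrak s$ (skew-symmetric), $ab\in B$, $ca\in C$, $T(b,c)\in A$, $D_{b,c}\in\mathfrak s$, $b_1\times b_2\in C$ and $c_1\times c_2\in B$ (both symmetric), and representations of $\mathfrak s$ on $A$, $B$ and $C$. Moreover, for any such maps, put $aa'=\frac12a\circ a'+\frac12[a,a']$. Then the vector space $\mathcal A=\begin{pmatrix}A&C\\B&A\end{pmatrix}$ with the multiplication \[ \begin{pmatrix}a_1&c\\b&a_2\end{pmatrix}\cdot\begin{pmatrix}a_1'&c'\\b'&a_2'\end{pmatrix}=\begin{pmatrix}a_1a_1'-T(b',c)&c'a_1+ca_2'+b\times b'\\a_1'b+a_2b'+c\times c'&a_2'a_2-T(b,c')\end{pmatrix} \] and the involution \[ \overline{\begin{pmatrix}a_1&c\\b&a_2\end{pmatrix}}=\begin{pmatrix}a_2&c\\b&a_1\end{pmatrix} \] is a structurable algebra with unit element $\begin{pmatrix}1&0\\0&1\end{pmatrix}$. That is, $\mathcal A$ is a unital (not necessarily associative) algebra, the map $X\mapsto\overline X$ is linear and satisfies $\overline{\overline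 X}=X$ and $\overline{X\cdot Y}=\overline Y\cdot\overline X$, and, with $V_{X,Y}Z=(X\cdot\overline Y)\cdot Z+(Z\cdot\overline Y)\cdot X-(Z\cdot\overline X)\cdot Y$, \[ [V_{X,Y},V_{Z,W}]=V_{V_{X,Y}Z,\,W}-V_{Z,\,V_{Y,X}W}\qquad\text{for all }X,Y,Z,W\in\mathcal A. \] -/

import Mathlib

open scoped TensorProduct

attribute [local instance 100] LieRing.ofAssociativeRing

namespace Sl3Lie

section LinearAlgebra

variable (F : Type*) [Field F] (V : Type*) [AddCommGroup V] [Module F V]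

/-- The Lie algebra `𝔰𝔩(V)` of trace zero endomorphisms of `V`, inside `End V` with the commutator
bracket. -/
def sl : LieSubalgebra F (Module.End F V) where
  carrier := {x | LinearMap.trace F V x = 0}
  add_mem' {x y} hx hy := by
    have hx' : LinearMap.trace F V x = 0 := hx
    have hy' : LinearMap.trace F V y = 0 := hy
    change LinearMap.trace F V (x + y) = 0
    rw [map_add, hx', hy', add_zero]
  zero_mem' := map_zero (LinearMap.trace F V)
  smul_mem' t x hx := by
    have hx' : LinearMap.trace F V x = 0 := hx
    change LinearMap.trace F V (t • x) = 0
    rw [map_smul, hx', smul_zero]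
  lie_mem' {x y} _ _ := by
    change LinearMap.trace F V ⁅x, y⁆ = 0
    rw [Ring.lie_def, map_sub, LinearMap.trace_mul_comm, sub_self]

variable {F V}

theorem mem_sl (x : Module.End F V) : x ∈ sl F V ↔ LinearMap.trace F V x = 0 := Iff.rfl

/-- The endomorphism `u v* : w ↦ (v* w) u`. -/
def rankOne (u : V) (f : Module.Dual F V) : Module.End F V := f.smulRight u

/-- The form `(x | y) = (1/3) tr (x y)`. -/
noncomputable def slForm (x y : sl F V) : F :=
  (1 / 3 : F) * LinearMap.trace F V ((x : Module.End F V) * (y : Module.End F V))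

/-- The product `x ∘ y = x y + y x - (2/3) tr (x y) I` on `𝔰𝔩(V)`, for `dim V = 3`. -/
noncomputable def slCirc (hV : Module.finrank F V = 3) (h3 : (3 : F) ≠ 0) (x y : sl F V) :
    sl F V :=
  ⟨(x : Module.End F V) * (y : Module.End F V) + (y : Module.End F V) * (x : Module.End F V)
      - ((2 / 3 : F) * LinearMap.trace F V ((x : Module.End F V) * (y : Module.End F V))) •
          (1 : Module.End F V), by
    have : Module.Finite F V := Module.finite_of_finrank_pos (by omega)
    rw [mem_sl, map_sub, map_add, map_smul, LinearMap.trace_mul_comm F (y : Module.End F V),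
      LinearMap.trace_one, hV, smul_eq_mul]
    push_cast
    field_simp
    ring⟩

/-- The traceless endomorphism `u v* - (1/3) (v* u) I`, for `dim V = 3`. -/
noncomputable def slRankOne (hV : Module.finrank F V = 3) (h3 : (3 : F) ≠ 0)
    (u : V) (f : Module.Dual F V) : sl F V :=
  ⟨rankOne u f - ((1 / 3 : F) * f u) • (1 : Module.End F V), by
    have : Module.Finite F V := Module.finite_of_finrank_pos (by omega)
    rw [mem_sl, map_sub, map_smul, rankOne, LinearMap.trace_smulRight, LinearMap.trace_one, hV,
      smul_eq_mul]
    push_cast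
    field_simp
    ring⟩

/-- The alternating form on `V*` induced by an alternating form `det` on `V`; it is characterized
by `detDual_mul_det`. -/
noncomputable def detDual (hV : Module.finrank F V = 3) (det : V [⋀^Fin 3]→ₗ[F] F) :
    (Module.Dual F V) [⋀^Fin 3]→ₗ[F] F :=
  have : Module.Finite F V := Module.finite_of_finrank_pos (by omega)
  (det (Module.finBasisOfFinrankEq F V hV))⁻¹ •
    (Module.finBasisOfFinrankEq F V hV).dualBasis.det

/-- `det (f₁ ∧ f₂ ∧ f₃) det (v₁ ∧ v₂ ∧ v₃)` is the determinant of the matrix `(fᵢ (vⱼ))`. -/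
theorem detDual_mul_det (hV : Module.finrank F V = 3) (det : V [⋀^Fin 3]→ₗ[F] F) (hdet : det ≠ 0)
    (f : Fin 3 → Module.Dual F V) (v : Fin 3 → V) :
    detDual hV det f * det v = (Matrix.of fun i j => f i (v j)).det := by
  have : Module.Finite F V := Module.finite_of_finrank_pos (by omega)
  set b := Module.finBasisOfFinrankEq F V hV with hb
  have h1 : det = det b • b.det := AlternatingMap.eq_smul_basis_det b det
  have h0 : det b ≠ 0 := by
    intro h
    rw [h, zero_smul] at h1
    exact hdet h1
  have h2 : det v = det b * b.det v := by
    conv_lhs => rw [h1]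
    simp
  have h3 : (Matrix.of fun i j => f i (v j)) = (b.dualBasis.toMatrix f).transpose * b.toMatrix v := by
    ext i j
    rw [Matrix.mul_apply, Matrix.of_apply]
    conv_lhs => rw [← b.sum_repr (v j)]
    rw [map_sum]
    refine Finset.sum_congr rfl fun k _ => ?_
    rw [map_smul, Matrix.transpose_apply, Module.Basis.toMatrix_apply, Module.Basis.toMatrix_apply,
      Module.Basis.dualBasis_repr, smul_eq_mul, mul_comm]
  rw [h3, Matrix.det_mul, Matrix.det_transpose, h2, detDual, AlternatingMap.smul_apply,
    Module.Basis.det_apply, Module.Basis.det_apply, smul_eq_mul, ← hb]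
  field_simp

/-- `u₁ ∧ u₂ ∈ V*`, through the identification `u₁ ∧ u₂ ↔ det (u₁ ∧ u₂ ∧ _)`. -/
def wedge (det : V [⋀^Fin 3]→ₗ[F] F) (u₁ u₂ : V) : Module.Dual F V where
  toFun v := det ![u₁, u₂, v]
  map_add' v w := by
    have key : ∀ z, Function.update ![u₁, u₂, 0] 2 z = ![u₁, u₂, z] := by
      intro z
      ext i
      fin_cases i <;> rfl
    rw [← key (v + w), ← key v, ← key w]
    exact det.map_update_add _ _ _ _
  map_smul' t v := by
    have key : ∀ z, Function.update ![u₁, u₂, 0] 2 z = ![u₁, u₂, z] := by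
      intro z
      ext i
      fin_cases i <;> rfl
    rw [← key (t • v), ← key v]
    exact det.map_update_smul _ _ _ _

/-- `f₁ ∧ f₂ ∈ V` for `f₁, f₂ ∈ V*`: the vector `w` with `f w = det (f₁ ∧ f₂ ∧ f)` for all `f`. -/
noncomputable def wedgeDual [Module.Finite F V] (hV : Module.finrank F V = 3)
    (det : V [⋀^Fin 3]→ₗ[F] F) (f₁ f₂ : Module.Dual F V) : V :=
  (Module.evalEquiv F V).symm (wedge (detDual hV det) f₁ f₂)

theorem apply_wedgeDual [Module.Finite F V] (hV : Module.finrank F V = 3)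
    (det : V [⋀^Fin 3]→ₗ[F] F) (f₁ f₂ f : Module.Dual F V) :
    f (wedgeDual hV det f₁ f₂) = detDual hV det ![f₁, f₂, f] := by
  rw [wedgeDual, Module.apply_evalEquiv_symm_apply]
  rfl

end LinearAlgebra

section Decomposition

variable {F : Type*} [Field F] {V : Type*} [AddCommGroup V] [Module F V]
  {L : Type*} [LieRing L] [LieAlgebra F L]

/-- The subalgebra of the elements of `L` annihilated by (the image of) `𝔰𝔩(V)`. -/
def slCentralizer (ι : sl F V →ₗ⁅F⁆ L) : LieSubalgebra F L where
  carrier := {d | ∀ x : sl F V, ⁅ι x, d⁆ = 0}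
  add_mem' {d d'} hd hd' := fun x => by rw [lie_add, hd x, hd' x, add_zero]
  zero_mem' := fun x => lie_zero (ι x)
  smul_mem' t d hd := fun x => by rw [lie_smul, hd x, smul_zero]
  lie_mem' {d d'} hd hd' := fun x => by
    rw [leibniz_lie, hd x, hd' x, zero_lie, lie_zero, add_zero]

variable (F V L)

/-- A Lie algebra `L` with a subalgebra isomorphic to `𝔰𝔩(V)` and a decomposition
`L = (𝔰𝔩(V) ⊗ A) ⊕ (V ⊗ B) ⊕ (V* ⊗ C) ⊕ 𝔰` as a module for `𝔰𝔩(V)`, where `𝔰` is the subalgebra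
annihilated by `𝔰𝔩(V)`. -/
structure Decomposition (A B C : Type*) [AddCommGroup A] [Module F A]
    [AddCommGroup B] [Module F B] [AddCommGroup C] [Module F C] where
  /-- the embedding of `𝔰𝔩(V)` into `L` -/
  ι : sl F V →ₗ⁅F⁆ L
  ι_injective : Function.Injective ι
  /-- the decomposition of `L` -/
  e : ((sl F V ⊗[F] A) × (V ⊗[F] B) × (Module.Dual F V ⊗[F] C) × slCentralizer ι) ≃ₗ[F] L
  e_centralizer : ∀ d : slCentralizer ι, e (0, 0, 0, d) = (d : L)
  lie_adjoint : ∀ (x y : sl F V) (a : A),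
    ⁅ι x, e (y ⊗ₜ[F] a, 0, 0, 0)⁆ = e (⁅x, y⁆ ⊗ₜ[F] a, 0, 0, 0)
  lie_natural : ∀ (x : sl F V) (u : V) (b : B),
    ⁅ι x, e (0, u ⊗ₜ[F] b, 0, 0)⁆ = e (0, (x : Module.End F V) u ⊗ₜ[F] b, 0, 0)
  lie_dual : ∀ (x : sl F V) (f : Module.Dual F V) (c : C),
    ⁅ι x, e (0, 0, f ⊗ₜ[F] c, 0)⁆ = e (0, 0, (-(f ∘ₗ (x : Module.End F V))) ⊗ₜ[F] c, 0)

variable {F V L} {A B C : Type*} [AddCommGroup A] [Module F A]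
  [AddCommGroup B] [Module F B] [AddCommGroup C] [Module F C]

namespace Decomposition

variable (D : Decomposition F V L A B C)

/-- The subalgebra `𝔰`. -/
abbrev s : LieSubalgebra F L := slCentralizer D.ι

/-- The element `x ⊗ a` of `L`. -/
def inA (x : sl F V) (a : A) : L := D.e (x ⊗ₜ[F] a, 0, 0, 0)

/-- The element `u ⊗ b` of `L`. -/
def inB (u : V) (b : B) : L := D.e (0, u ⊗ₜ[F] b, 0, 0)

/-- The element `v* ⊗ c` of `L`. -/
def inC (f : Module.Dual F V) (c : C) : L := D.e (0, 0, f ⊗ₜ[F] c, 0)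

end Decomposition

/-- The bilinear maps and representations in terms of which the bracket of `L` is written
(`S` is the Lie algebra `𝔰`). -/
structure CoordMaps (F A B C S : Type*) [Field F] [AddCommGroup A] [Module F A]
    [AddCommGroup B] [Module F B] [AddCommGroup C] [Module F C] [LieRing S] [LieAlgebra F S] where
  /-- `a ∘ a'` -/
  circ : A →ₗ[F] A →ₗ[F] A
  /-- `[a, a']` -/
  comm : A →ₗ[F] A →ₗ[F] A
  /-- `D_{a, a'}` -/
  derA : A →ₗ[F] A →ₗ[F] S
  /-- `a b` -/
  actB : A →ₗ[F] B →ₗ[F] B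
  /-- `c a` -/
  actC : C →ₗ[F] A →ₗ[F] C
  /-- `T (b, c)` -/
  T : B →ₗ[F] C →ₗ[F] A
  /-- `D_{b, c}` -/
  derBC : B →ₗ[F] C →ₗ[F] S
  /-- `b₁ × b₂` -/
  crossB : B →ₗ[F] B →ₗ[F] C
  /-- `c₁ × c₂` -/
  crossC : C →ₗ[F] C →ₗ[F] B
  /-- the representation of `𝔰` on `A` -/
  repA : S →ₗ⁅F⁆ Module.End F A
  /-- the representation of `𝔰` on `B` -/
  repB : S →ₗ⁅F⁆ Module.End F B
  /-- the representation of `𝔰` on `C` -/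
  repC : S →ₗ⁅F⁆ Module.End F C

/-- The bracket of `L` is given by the maps `m`, which have the stated symmetries. -/
structure IsCoordinatizedBy [Module.Finite F V] (hV : Module.finrank F V = 3) (h3 : (3 : F) ≠ 0)
    (det : V [⋀^Fin 3]→ₗ[F] F) (D : Decomposition F V L A B C) (m : CoordMaps F A B C D.s) :
    Prop where
  circ_comm : ∀ a a', m.circ a a' = m.circ a' a
  comm_anticomm : ∀ a a', m.comm a a' = -m.comm a' a
  derA_skew : ∀ a a', m.derA a a' = -m.derA a' a
  crossB_symm : ∀ b₁ b₂, m.crossB b₁ b₂ = m.crossB b₂ b₁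
  crossC_symm : ∀ c₁ c₂, m.crossC c₁ c₂ = m.crossC c₂ c₁
  lie_A_A : ∀ (x y : sl F V) (a a' : A),
    ⁅D.inA x a, D.inA y a'⁆ =
      D.inA ⁅x, y⁆ ((1 / 2 : F) • m.circ a a')
        + D.inA (slCirc hV h3 x y) ((1 / 2 : F) • m.comm a a')
        + slForm x y • (m.derA a a' : L)
  lie_A_B : ∀ (x : sl F V) (u : V) (a : A) (b : B),
    ⁅D.inA x a, D.inB u b⁆ = D.inB ((x : Module.End F V) u) (m.actB a b)
  lie_C_A : ∀ (f : Module.Dual F V) (x : sl F V) (c : C) (a : A),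
    ⁅D.inC f c, D.inA x a⁆ = D.inC (f ∘ₗ (x : Module.End F V)) (m.actC c a)
  lie_B_C : ∀ (u : V) (f : Module.Dual F V) (b : B) (c : C),
    ⁅D.inB u b, D.inC f c⁆ =
      D.inA (slRankOne hV h3 u f) (m.T b c) + ((1 / 3 : F) * f u) • (m.derBC b c : L)
  lie_B_B : ∀ (u₁ u₂ : V) (b₁ b₂ : B),
    ⁅D.inB u₁ b₁, D.inB u₂ b₂⁆ = D.inC (wedge det u₁ u₂) (m.crossB b₁ b₂)
  lie_C_C : ∀ (f₁ f₂ : Module.Dual F V) (c₁ c₂ : C),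
    ⁅D.inC f₁ c₁, D.inC f₂ c₂⁆ = D.inB (wedgeDual hV det f₁ f₂) (m.crossC c₁ c₂)
  lie_s_A : ∀ (d : D.s) (x : sl F V) (a : A), ⁅(d : L), D.inA x a⁆ = D.inA x (m.repA d a)
  lie_s_B : ∀ (d : D.s) (u : V) (b : B), ⁅(d : L), D.inB u b⁆ = D.inB u (m.repB d b)
  lie_s_C : ∀ (d : D.s) (f : Module.Dual F V) (c : C),
    ⁅(d : L), D.inC f c⁆ = D.inC f (m.repC d c)

end Decomposition

section Structurable

/-- The operator `V_{x,y} z = (x ȳ) z + (z ȳ) x - (z x̄) y` of an algebra with product `mul` and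
involution `bar`. -/
def structV {F M : Type*} [Field F] [AddCommGroup M] [Module F M]
    (mul : M →ₗ[F] M →ₗ[F] M) (bar : M →ₗ[F] M) (x y z : M) : M :=
  mul (mul x (bar y)) z + mul (mul z (bar y)) x - mul (mul z (bar x)) y

/-- A structurable algebra: a unital, not necessarily associative algebra with product `mul`, unit
`one` and involution `bar` such that `[V_{x,y}, V_{z,w}] = V_{V_{x,y} z, w} - V_{z, V_{y,x} w}`,
where `V_{x,y} z = (x ȳ) z + (z ȳ) x - (z x̄) y`. -/
structure IsStructurable {F M : Type*} [Field F] [AddCommGroup M] [Module F M]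
    (mul : M →ₗ[F] M →ₗ[F] M) (bar : M →ₗ[F] M) (one : M) : Prop where
  one_mul : ∀ x, mul one x = x
  mul_one : ∀ x, mul x one = x
  bar_bar : ∀ x, bar (bar x) = x
  bar_mul : ∀ x y, bar (mul x y) = mul (bar y) (bar x)
  lie_structV : ∀ x y z w t,
    structV mul bar x y (structV mul bar z w t) - structV mul bar z w (structV mul bar x y t) =
      structV mul bar (structV mul bar x y z) w t - structV mul bar z (structV mul bar y x w) t

variable {F A B C S : Type*} [Field F] [AddCommGroup A] [Module F A]
  [AddCommGroup B] [Module F B] [AddCommGroup C] [Module F C] [LieRing S] [LieAlgebra F S]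

/-- The space of matrices `(a₁, c; b, a₂)` with diagonal entries in `A`, upper right entry in `C`
and lower left entry in `B`; the matrix is written as the tuple `(a₁, c, b, a₂)`. -/
abbrev MatSpace (A B C : Type*) : Type _ := A × C × B × A

/-- The product `a a' = (1/2) a ∘ a' + (1/2) [a, a']` of `A`. -/
noncomputable def CoordMaps.mulA (m : CoordMaps F A B C S) (a a' : A) : A :=
  (1 / 2 : F) • m.circ a a' + (1 / 2 : F) • m.comm a a'

/-- The product of the matrix space. -/
noncomputable def matMul (m : CoordMaps F A B C S) :
    MatSpace A B C →ₗ[F] MatSpace A B C →ₗ[F] MatSpace A B C :=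
  LinearMap.mk₂ F
    (fun X Y =>
      match X, Y with
      | (a₁, c, b, a₂), (a₁', c', b', a₂') =>
        (m.mulA a₁ a₁' - m.T b' c,
          m.actC c' a₁ + m.actC c a₂' + m.crossB b b',
          m.actB a₁' b + m.actB a₂ b' + m.crossC c c',
          m.mulA a₂' a₂ - m.T b c'))
    (by
      rintro ⟨_, _, _, _⟩ ⟨_, _, _, _⟩ ⟨_, _, _, _⟩
      simp only [CoordMaps.mulA, Prod.mk_add_mk, map_add, LinearMap.add_apply, smul_add,
        Prod.mk.injEq]
      refine ⟨?_, ?_, ?_, ?_⟩ <;> abel)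
    (by
      rintro t ⟨_, _, _, _⟩ ⟨_, _, _, _⟩
      simp only [CoordMaps.mulA, Prod.smul_mk, map_smul, LinearMap.smul_apply, smul_add, smul_sub,
        smul_comm t (1 / 2 : F)])
    (by
      rintro ⟨_, _, _, _⟩ ⟨_, _, _, _⟩ ⟨_, _, _, _⟩
      simp only [CoordMaps.mulA, Prod.mk_add_mk, map_add, LinearMap.add_apply, smul_add,
        Prod.mk.injEq]
      refine ⟨?_, ?_, ?_, ?_⟩ <;> abel)
    (by
      rintro t ⟨_, _, _, _⟩ ⟨_, _, _, _⟩
      simp only [CoordMaps.mulA, Prod.smul_mk, map_smul, LinearMap.smul_apply, smul_add, smul_sub,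
        smul_comm t (1 / 2 : F)])

/-- The involution of the matrix space: it exchanges the two diagonal entries. -/
def matBar (F A B C : Type*) [Field F] [AddCommGroup A] [Module F A]
    [AddCommGroup B] [Module F B] [AddCommGroup C] [Module F C] :
    MatSpace A B C →ₗ[F] MatSpace A B C where
  toFun X := match X with
    | (a₁, c, b, a₂) => (a₂, c, b, a₁)
  map_add' := by
    rintro ⟨_, _, _, _⟩ ⟨_, _, _, _⟩
    rfl
  map_smul' := by
    rintro t ⟨_, _, _, _⟩
    rfl

end Structurable

end Sl3Lie

/-! The bracket formulas. Choose a basis `v` with `det v = 1` and let the traceless diagonal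
matrices act on `L` through `ι`. Because 2 and 3 are invertible, the nonzero weights occurring in
`L` (the roots, the weights of `V` and those of `V*`) stay distinct from each other and from 0. A
weight vector with one of these weights therefore has the form `E i j ⊗ a`, `v i ⊗ b` or `v i* ⊗ c`
(`HasWt.eq_inA`, `HasWt.eq_inB`, `HasWt.eq_inC`), and a vector whose weight does not occur is 0
(`HasWt.eq_zero`). So a bracket of two such vectors with nonzero total weight is either 0 or given
by a bilinear expression in the coefficients. Applying root elements of `𝔰𝔩(V)` permutes the indices
and shows that the expression does not depend on them. When the total weight is 0, one subtracts the
diagonal part that the other brackets dictate. The remainder is killed by all root elements, hence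
lies in `𝔰` (`eq_projS`), and defines `D_{a,a'}` or `D_{b,c}`. Linearity and equivariance
(`sl_hom_ext`, `bilin_ext`) carry the formulas from the basis to arbitrary vectors.

Structurability. With respect to `E 0 0 - E 2 2`, all weights lie between -2 and 2. The degree 1
part, spanned by `E 0 1 ⊗ A`, `v 2* ⊗ C`, `v 0 ⊗ B` and `E 1 2 ⊗ A`, is a copy of the matrix space
(`posPart`), and so is the degree -1 part (`negPart`). The main computation, `lie_lie_posPart`,
states that `[[X⁺, Y⁻], Z⁺] = (V_{X,Y} Z)⁺`. Reversing the basis exchanges the two parts up to sign,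
which gives `[[X⁺, Y⁻], W⁻] = -(V_{Y,X} W)⁻` (`lie_lie_negPart`). The identity for `[V_{X,Y},
V_{Z,W}]` is then the Jacobi identity for `[[X⁺, Y⁻], [Z⁺, W⁻]]` acting on degree 1.

The derivations `D_{a,a'}` and `D_{b,c}` never have to be evaluated: whenever opposite weights meet,
the third factor is written as a bracket involving `1 ∈ A`, and Jacobi then leads only to brackets
without a component in `𝔰`. -/

namespace Sl3Lie

/-! ### Traceless matrix units. -/

section SlBasics

variable {F : Type*} [Field F] {V : Type*} [AddCommGroup V] [Module F V]
  (hV : Module.finrank F V = 3) (h3 : (3 : F) ≠ 0)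

theorem coe_slRankOne_apply (u : V) (f : Module.Dual F V) (w : V) :
    (slRankOne hV h3 u f : Module.End F V) w = f w • u - ((1 / 3 : F) * f u) • w := by
  simp [slRankOne, rankOne]

theorem sl_ext {x y : sl F V} (h : ∀ w, (x : Module.End F V) w = (y : Module.End F V) w) :
    x = y :=
  Subtype.ext (LinearMap.ext h)

theorem coe_add_apply (x y : sl F V) (w : V) :
    ((x + y : sl F V) : Module.End F V) w =
      (x : Module.End F V) w + (y : Module.End F V) w := rfl

theorem coe_sub_apply (x y : sl F V) (w : V) :
    ((x - y : sl F V) : Module.End F V) w =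
      (x : Module.End F V) w - (y : Module.End F V) w := rfl

theorem coe_smul_apply (t : F) (x : sl F V) (w : V) :
    ((t • x : sl F V) : Module.End F V) w = t • (x : Module.End F V) w := rfl

theorem coe_zero_apply (w : V) : ((0 : sl F V) : Module.End F V) w = 0 := rfl

theorem coe_lie_apply (x y : sl F V) (w : V) :
    ((⁅x, y⁆ : sl F V) : Module.End F V) w =
      (x : Module.End F V) ((y : Module.End F V) w) -
        (y : Module.End F V) ((x : Module.End F V) w) := by
  rw [LieSubalgebra.coe_bracket, Ring.lie_def]
  rfl

theorem lie_slRankOne (x : sl F V) (u : V) (f : Module.Dual F V) :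
    ⁅x, slRankOne hV h3 u f⁆ =
      slRankOne hV h3 ((x : Module.End F V) u) f -
        slRankOne hV h3 u (f ∘ₗ (x : Module.End F V)) := by
  refine sl_ext fun w => ?_
  rw [coe_lie_apply, coe_sub_apply]
  simp only [coe_slRankOne_apply, map_sub, map_smul, LinearMap.comp_apply]
  module

/-- The matrix unit `v i (v j)*`, made traceless. -/
noncomputable def slUnit (v : Module.Basis (Fin 3) F V) (i j : Fin 3) : sl F V :=
  slRankOne hV h3 (v i) (v.coord j)

variable (v : Module.Basis (Fin 3) F V)

theorem coe_slUnit_apply_basis (i j k : Fin 3) :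
    (slUnit hV h3 v i j : Module.End F V) (v k) =
      (if j = k then v i else 0) - (if i = j then (1 / 3 : F) • v k else 0) := by
  rw [slUnit, coe_slRankOne_apply]
  simp only [Module.Basis.coord_apply, Module.Basis.repr_self, Finsupp.single_apply, eq_comm]
  split_ifs <;> simp

theorem coord_comp_slUnit (i j k : Fin 3) :
    v.coord k ∘ₗ (slUnit hV h3 v i j : Module.End F V) =
      (if i = k then v.coord j else 0) - (if i = j then (1 / 3 : F) • v.coord k else 0) := by
  refine LinearMap.ext fun w => ?_
  rw [LinearMap.comp_apply, slUnit, coe_slRankOne_apply]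
  simp only [Module.Basis.coord_apply, Module.Basis.repr_self, Finsupp.single_apply, eq_comm,
    map_sub, map_smul]
  split_ifs <;> simp_all

theorem lie_slUnit (i j k l : Fin 3) :
    ⁅slUnit hV h3 v i j, slUnit hV h3 v k l⁆ =
      (if j = k then slUnit hV h3 v i l else 0) - (if i = l then slUnit hV h3 v k j else 0) := by
  rw [slUnit, slUnit, lie_slRankOne, ← slUnit, coe_slUnit_apply_basis, coord_comp_slUnit]
  refine sl_ext fun w => ?_
  split_ifs <;> subst_vars <;>
    simp [slUnit, coe_slRankOne_apply, Finsupp.single_apply, *] <;>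
    module

/-- A traceless endomorphism is the combination of matrix units given by its matrix. -/
theorem sum_slUnit (x : sl F V) :
    ∑ i, ∑ j, v.coord i ((x : Module.End F V) (v j)) • slUnit hV h3 v i j = x := by
  have htr : ∑ i, v.coord i ((x : Module.End F V) (v i)) = 0 := by
    have h := (mem_sl (x : Module.End F V)).1 x.2
    rw [LinearMap.trace_eq_matrix_trace F v, Matrix.trace] at h
    simpa [LinearMap.toMatrix_apply] using h
  refine Subtype.ext (v.ext fun k => ?_)
  have hk := v.sum_repr ((x : Module.End F V) (v k))
  simp only [AddSubmonoidClass.coe_finsetSum, LinearMap.sum_apply, coe_smul_apply,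
    coe_slUnit_apply_basis]
  simp only [smul_sub, Finset.sum_sub_distrib, smul_ite, smul_zero, Finset.sum_ite_eq,
    Finset.sum_ite_eq', Finset.mem_univ, if_true, Module.Basis.coord_apply] at htr ⊢
  rw [hk, ← Finset.sum_smul, htr, zero_smul, sub_zero]

/-- Each bracket of opposite root elements is a difference of diagonal units, and the three
traceless diagonal units sum to 0. Since 3 is invertible, root elements and their opposite brackets
therefore span `𝔰𝔩(V)`. -/
theorem smul_slUnit_self (i j k : Fin 3) (hij : i ≠ j) (hik : i ≠ k) (hjk : j ≠ k) :
    (3 : F) • slUnit hV h3 v i i =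
      ⁅slUnit hV h3 v i j, slUnit hV h3 v j i⁆ + ⁅slUnit hV h3 v i k, slUnit hV h3 v k i⁆ := by
  have h : slUnit hV h3 v i i + slUnit hV h3 v j j + slUnit hV h3 v k k = 0 := by
    refine Subtype.ext (v.ext fun l => ?_)
    simp only [coe_add_apply, coe_slUnit_apply_basis, if_true]
    have hl : l = i ∨ l = j ∨ l = k := by omega
    have e3 : (1 : F) = 1/3 + 1/3 + 1/3 := by field_simp; norm_num
    rcases hl with rfl | rfl | rfl <;> simp [hij, hik, hjk, hij.symm, hik.symm, hjk.symm] <;>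
    · match_scalars
      field_simp
      ring
  simp only [lie_slUnit, if_true]
  rw [eq_comm, ← sub_eq_zero, ← neg_eq_zero, ← h]
  module

/-- Two linear maps on `𝔰𝔩(V)` that agree on the root elements and on their opposite brackets are
equal. -/
theorem sl_hom_ext {W : Type*} [AddCommGroup W] [Module F W] {φ ψ : sl F V →ₗ[F] W}
    (h : ∀ i j, i ≠ j → φ (slUnit hV h3 v i j) = ψ (slUnit hV h3 v i j))
    (h' : ∀ i j, i ≠ j → φ ⁅slUnit hV h3 v i j, slUnit hV h3 v j i⁆ =
      ψ ⁅slUnit hV h3 v i j, slUnit hV h3 v j i⁆) : φ = ψ := by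
  have hii : ∀ i j k : Fin 3, i ≠ j → i ≠ k → j ≠ k →
      φ (slUnit hV h3 v i i) = ψ (slUnit hV h3 v i i) := by
    intro i j k hij hik hjk
    have := smul_slUnit_self hV h3 v i j k hij hik hjk
    have e : (3 : F) • φ (slUnit hV h3 v i i) = (3 : F) • ψ (slUnit hV h3 v i i) := by
      rw [← map_smul, ← map_smul, this, map_add, map_add, h' i j hij, h' i k hik]
    exact smul_right_injective W h3 e
  refine LinearMap.ext fun x => ?_
  rw [← sum_slUnit hV h3 v x]
  simp only [map_sum, map_smul]
  refine Finset.sum_congr rfl fun i _ => Finset.sum_congr rfl fun j _ => ?_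
  by_cases hij : i = j
  · subst hij
    rw [hii i (i + 1) (i + 2) (by revert i; decide) (by revert i; decide) (by revert i; decide)]
  · rw [h i j hij]

end SlBasics

/-! ### Weights and their separation in characteristic other than 2 and 3. -/

section Weights

/-- The weight of the `i`-th basis vector. -/
def wtU (i : Fin 3) : Fin 3 → ℤ := fun k => if k = i then 1 else 0

/-- The weight of the `(i, j)` matrix unit. -/
def wtE (i j : Fin 3) : Fin 3 → ℤ := fun k => (if k = i then 1 else 0) - (if k = j then 1 else 0)

/-- Two weights differ, on the traceless diagonal matrices, in every characteristic other than `2`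
and `3`. -/
abbrev WtSep (w w' : Fin 3 → ℤ) : Prop :=
  Int.gcd (w 0 - w 1 - (w' 0 - w' 1)) (w 1 - w 2 - (w' 1 - w' 2)) ∣ 36

/-- By Bézout, 36 is an integral combination of `p` and `q`, and it is invertible in `F` because its
only prime factors are 2 and 3. Equal weights give gcd 0, which does not divide 36, so `WtSep` does
exclude them. -/
theorem eq_zero_of_gcd_dvd {F W : Type*} [Field F] [AddCommGroup W] [Module F W]
    (h2 : (2 : F) ≠ 0) (h3 : (3 : F) ≠ 0) {p q : ℤ} (h : Int.gcd p q ∣ 36) {x : W}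
    (hp : (p : F) • x = 0) (hq : (q : F) • x = 0) : x = 0 := by
  obtain ⟨r, hr⟩ := h
  have hg : ((36 : ℕ) : F) • x = 0 := by
    have e : ((36 : ℕ) : ℤ) = p * (Int.gcdA p q * r) + q * (Int.gcdB p q * r) := by
      rw [hr, Nat.cast_mul, Int.gcd_eq_gcd_ab]
      ring
    have e' := congrArg (Int.cast : ℤ → F) e
    rw [Int.cast_natCast] at e'
    rw [e']
    push_cast
    rw [add_smul, mul_comm, mul_smul, hp, smul_zero, mul_comm (q : F), mul_smul, hq, smul_zero,
      add_zero]
  have h36 : ((36 : ℕ) : F) ≠ 0 := by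
    have e : ((36 : ℕ) : F) = 2 * 2 * (3 * 3) := by norm_num
    rw [e]
    exact mul_ne_zero (mul_ne_zero h2 h2) (mul_ne_zero h3 h3)
  exact (smul_eq_zero.1 hg).resolve_left h36

end Weights

/-! ### Components, coordinates and weight vectors of `L`. -/

namespace Decomposition

variable {F : Type*} [Field F] {V : Type*} [AddCommGroup V] [Module F V]
  {L : Type*} [LieRing L] [LieAlgebra F L] {A B C : Type*} [AddCommGroup A] [Module F A]
  [AddCommGroup B] [Module F B] [AddCommGroup C] [Module F C]
  (D : Decomposition F V L A B C)

/-- `x ⊗ a`, as a bilinear map. -/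
noncomputable def linA : sl F V →ₗ[F] A →ₗ[F] L :=
  (TensorProduct.mk F (sl F V) A).compr₂ (D.e.toLinearMap ∘ₗ LinearMap.inl F _ _)

/-- `u ⊗ b`, as a bilinear map. -/
noncomputable def linB : V →ₗ[F] B →ₗ[F] L :=
  (TensorProduct.mk F V B).compr₂
    (D.e.toLinearMap ∘ₗ LinearMap.inr F _ _ ∘ₗ LinearMap.inl F _ _)

/-- `v* ⊗ c`, as a bilinear map. -/
noncomputable def linC : Module.Dual F V →ₗ[F] C →ₗ[F] L :=
  (TensorProduct.mk F (Module.Dual F V) C).compr₂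
    (D.e.toLinearMap ∘ₗ LinearMap.inr F _ _ ∘ₗ LinearMap.inr F _ _ ∘ₗ LinearMap.inl F _ _)

theorem linA_apply (x : sl F V) (a : A) : D.linA x a = D.inA x a := rfl
theorem linB_apply (u : V) (b : B) : D.linB u b = D.inB u b := rfl
theorem linC_apply (f : Module.Dual F V) (c : C) : D.linC f c = D.inC f c := rfl

/-- The component of an element of `L` in `𝔰`. -/
noncomputable def projS : L →ₗ[F] D.s :=
  LinearMap.snd F _ _ ∘ₗ LinearMap.snd F _ _ ∘ₗ LinearMap.snd F _ _ ∘ₗ D.e.symm.toLinearMap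

/-- The `A`-valued coordinate of an element of `L` given by a functional on `𝔰𝔩(V)`. -/
noncomputable def contractA (φ : sl F V →ₗ[F] F) : L →ₗ[F] A :=
  (TensorProduct.lid F A).toLinearMap ∘ₗ φ.rTensor A ∘ₗ LinearMap.fst F _ _ ∘ₗ
    D.e.symm.toLinearMap

/-- The `B`-valued coordinate of an element of `L` given by a functional on `V`. -/
noncomputable def contractB (φ : V →ₗ[F] F) : L →ₗ[F] B :=
  (TensorProduct.lid F B).toLinearMap ∘ₗ φ.rTensor B ∘ₗ LinearMap.fst F _ _ ∘ₗ
    LinearMap.snd F _ _ ∘ₗ D.e.symm.toLinearMap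

/-- The `C`-valued coordinate of an element of `L` given by a functional on `V*`. -/
noncomputable def contractC (φ : Module.Dual F V →ₗ[F] F) : L →ₗ[F] C :=
  (TensorProduct.lid F C).toLinearMap ∘ₗ φ.rTensor C ∘ₗ LinearMap.fst F _ _ ∘ₗ
    LinearMap.snd F _ _ ∘ₗ LinearMap.snd F _ _ ∘ₗ D.e.symm.toLinearMap

section Values

variable (x : sl F V) (a : A) (u : V) (b : B) (f : Module.Dual F V) (c : C) (d : D.s)

@[simp] theorem projS_inA : D.projS (D.inA x a) = 0 := by simp [projS, inA]
@[simp] theorem projS_inB : D.projS (D.inB u b) = 0 := by simp [projS, inB]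
@[simp] theorem projS_inC : D.projS (D.inC f c) = 0 := by simp [projS, inC]
@[simp] theorem projS_coe : D.projS d = d := by simp [projS, ← D.e_centralizer]

@[simp] theorem contractA_inA (φ) : D.contractA φ (D.inA x a) = φ x • a := by simp [contractA, inA]
@[simp] theorem contractA_inB (φ) : D.contractA φ (D.inB u b) = 0 := by simp [contractA, inB]
@[simp] theorem contractA_inC (φ) : D.contractA φ (D.inC f c) = 0 := by simp [contractA, inC]
@[simp] theorem contractA_coe (φ) : D.contractA φ d = 0 := by
  simp [contractA, ← D.e_centralizer]

@[simp] theorem contractB_inA (φ) : D.contractB φ (D.inA x a) = 0 := by simp [contractB, inA]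
@[simp] theorem contractB_inB (φ) : D.contractB φ (D.inB u b) = φ u • b := by simp [contractB, inB]
@[simp] theorem contractB_inC (φ) : D.contractB φ (D.inC f c) = 0 := by simp [contractB, inC]
@[simp] theorem contractB_coe (φ) : D.contractB φ d = 0 := by
  simp [contractB, ← D.e_centralizer]

@[simp] theorem contractC_inA (φ) : D.contractC φ (D.inA x a) = 0 := by simp [contractC, inA]
@[simp] theorem contractC_inB (φ) : D.contractC φ (D.inB u b) = 0 := by simp [contractC, inB]
@[simp] theorem contractC_inC (φ) : D.contractC φ (D.inC f c) = φ f • c := by simp [contractC, inC]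
@[simp] theorem contractC_coe (φ) : D.contractC φ d = 0 := by
  simp [contractC, ← D.e_centralizer]

theorem lie_coe : ⁅D.ι x, (d : L)⁆ = 0 := d.2 x

theorem lie_inA (y : sl F V) : ⁅D.ι x, D.inA y a⁆ = D.inA ⁅x, y⁆ a := D.lie_adjoint x y a

theorem lie_inB : ⁅D.ι x, D.inB u b⁆ = D.inB ((x : Module.End F V) u) b := D.lie_natural x u b

theorem lie_inC : ⁅D.ι x, D.inC f c⁆ = -D.inC (f ∘ₗ (x : Module.End F V)) c := by
  rw [inC, lie_dual, ← inC, ← linC_apply, map_neg, LinearMap.neg_apply, linC_apply]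

end Values

/-- Linear maps on `L` are determined by their values on the four kinds of elements. -/
theorem hom_ext {W : Type*} [AddCommGroup W] [Module F W] {φ ψ : L →ₗ[F] W}
    (hA : ∀ x a, φ (D.inA x a) = ψ (D.inA x a)) (hB : ∀ u b, φ (D.inB u b) = ψ (D.inB u b))
    (hC : ∀ f c, φ (D.inC f c) = ψ (D.inC f c)) (hS : ∀ d : D.s, φ d = ψ d) : φ = ψ := by
  have h : φ ∘ₗ D.e.toLinearMap = ψ ∘ₗ D.e.toLinearMap := by
    refine LinearMap.prod_ext ?_ (LinearMap.prod_ext ?_ (LinearMap.prod_ext ?_ ?_))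
    · exact TensorProduct.ext' hA
    · exact TensorProduct.ext' hB
    · exact TensorProduct.ext' hC
    · refine LinearMap.ext fun d => ?_
      have := hS d
      rw [← D.e_centralizer d] at this
      exact this
  refine LinearMap.ext fun z => ?_
  have := LinearMap.congr_fun h (D.e.symm z)
  simpa using this

variable (v : Module.Basis (Fin 3) F V)

/-- The `A`-valued matrix entries of an element of `L`. -/
noncomputable def coordA (i j : Fin 3) : L →ₗ[F] A :=
  D.contractA (v.coord i ∘ₗ LinearMap.applyₗ (v j) ∘ₗ (sl F V).toSubmodule.subtype)

/-- The `B`-valued coordinates of an element of `L`. -/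
noncomputable def coordB (i : Fin 3) : L →ₗ[F] B := D.contractB (v.coord i)

/-- The `C`-valued coordinates of an element of `L`. -/
noncomputable def coordC (i : Fin 3) : L →ₗ[F] C := D.contractC (LinearMap.applyₗ (v i))

@[simp] theorem coordA_inA (i j : Fin 3) (x : sl F V) (a : A) :
    D.coordA v i j (D.inA x a) = v.coord i ((x : Module.End F V) (v j)) • a := by
  rw [coordA, contractA_inA]
  rfl
@[simp] theorem coordB_inB (i : Fin 3) (u : V) (b : B) :
    D.coordB v i (D.inB u b) = v.coord i u • b := by
  rw [coordB, contractB_inB]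
@[simp] theorem coordC_inC (i : Fin 3) (f : Module.Dual F V) (c : C) :
    D.coordC v i (D.inC f c) = f (v i) • c := by
  rw [coordC, contractC_inC]
  rfl

variable (hV : Module.finrank F V = 3) (h3 : (3 : F) ≠ 0)

/-- An element of `L` in terms of its coordinates. -/
theorem eq_sum_coord (z : L) :
    z = ∑ i, ∑ j, D.inA (slUnit hV h3 v i j) (D.coordA v i j z)
      + ∑ i, D.inB (v i) (D.coordB v i z) + ∑ i, D.inC (v.coord i) (D.coordC v i z)
      + (D.projS z : L) := by
  have key : (LinearMap.id : L →ₗ[F] L) =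
      ∑ i, ∑ j, D.linA (slUnit hV h3 v i j) ∘ₗ D.coordA v i j
      + ∑ i, D.linB (v i) ∘ₗ D.coordB v i + ∑ i, D.linC (v.coord i) ∘ₗ D.coordC v i
      + ((D.s.incl : D.s →ₗ[F] L) ∘ₗ D.projS) := by
    refine D.hom_ext ?_ ?_ ?_ ?_
    · intro x a
      conv_lhs => rw [← sum_slUnit hV h3 v x]
      simp [LinearMap.sum_apply, ← linA_apply, coordB, coordC]
      simp [linA_apply]
    · intro u b
      simp [LinearMap.sum_apply, ← linB_apply, coordA, coordC]
      simp only [linB_apply, projS_inB, coordB_inB, Module.Basis.coord_apply, contractA_inB,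
        contractC_inB, map_zero, Finset.sum_const_zero, zero_add]
      simp only [← linB_apply, map_smul, ZeroMemClass.coe_zero, add_zero]
      conv_lhs => rw [← v.sum_repr u]
      simp only [map_sum, LinearMap.sum_apply, map_smul, LinearMap.smul_apply]
    · intro f c
      have hf : f = ∑ i, f (v i) • v.coord i := v.ext fun k => by
        simp
      simp [LinearMap.sum_apply, ← linC_apply, coordA, coordB]
      simp only [linC_apply, projS_inC, coordC_inC, contractA_inC, contractB_inC, map_zero,
        Finset.sum_const_zero, zero_add]
      simp only [← linC_apply, map_smul, ZeroMemClass.coe_zero, add_zero]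
      conv_lhs => rw [hf]
      simp only [map_sum, LinearMap.sum_apply, map_smul, LinearMap.smul_apply]
    · intro d
      simp [LinearMap.sum_apply, coordA, coordB, coordC]
  have := LinearMap.congr_fun key z
  simpa [LinearMap.sum_apply, linA_apply, linB_apply, linC_apply] using this

/-- `z` is a weight vector of weight `w` for the traceless diagonal matrices. -/
def HasWt (w : Fin 3 → ℤ) (z : L) : Prop :=
  ∀ k l, ⁅D.ι (slUnit hV h3 v k k - slUnit hV h3 v l l), z⁆ = ((w k - w l : ℤ) : F) • z

variable {D v hV h3}

/-- Only differences of entries are seen by traceless diagonal matrices, so weights count modulo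
`(1, 1, 1)`. This is what identifies the weight of `v i ∧ v j` with that of a dual basis vector. -/
theorem HasWt.congr {w w' : Fin 3 → ℤ} {z : L} (h : D.HasWt v hV h3 w z)
    (hw : ∀ k l, w k - w l = w' k - w' l) : D.HasWt v hV h3 w' z := fun k l => by
  rw [h k l, hw]

theorem HasWt.lie {w w' : Fin 3 → ℤ} {y z : L} (hy : D.HasWt v hV h3 w y)
    (hz : D.HasWt v hV h3 w' z) : D.HasWt v hV h3 (w + w') ⁅y, z⁆ := fun k l => by
  rw [leibniz_lie, hy k l, hz k l, smul_lie, lie_smul, ← add_smul]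
  congr 1
  simp only [Pi.add_apply]
  push_cast
  ring

variable (D v hV h3)

theorem slDiag_apply_basis (k l j : Fin 3) :
    ((slUnit hV h3 v k k - slUnit hV h3 v l l : sl F V) : Module.End F V) (v j) =
      ((wtU j k - wtU j l : ℤ) : F) • v j := by
  rw [coe_sub_apply, coe_slUnit_apply_basis, coe_slUnit_apply_basis]
  simp only [wtU, if_true]
  split_ifs <;> subst_vars <;> (simp; try module)

theorem coord_slDiag (k l i : Fin 3) :
    v.coord i ∘ₗ ((slUnit hV h3 v k k - slUnit hV h3 v l l : sl F V) : Module.End F V) =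
      ((wtU i k - wtU i l : ℤ) : F) • v.coord i := by
  refine v.ext fun j => ?_
  rw [LinearMap.comp_apply, slDiag_apply_basis, map_smul, LinearMap.smul_apply]
  by_cases h : i = j
  · rw [h]
  · simp [Ne.symm h]

theorem lie_slDiag_slUnit (k l i j : Fin 3) :
    ⁅slUnit hV h3 v k k - slUnit hV h3 v l l, slUnit hV h3 v i j⁆ =
      ((wtE i j k - wtE i j l : ℤ) : F) • slUnit hV h3 v i j := by
  rw [sub_lie, lie_slUnit, lie_slUnit]
  simp only [wtE]
  split_ifs <;> subst_vars <;> simp <;> module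

theorem hasWt_inA (i j : Fin 3) (a : A) :
    D.HasWt v hV h3 (wtE i j) (D.inA (slUnit hV h3 v i j) a) := fun k l => by
  rw [lie_inA, lie_slDiag_slUnit, ← linA_apply, map_smul, LinearMap.smul_apply, linA_apply]

theorem hasWt_inB (i : Fin 3) (b : B) : D.HasWt v hV h3 (wtU i) (D.inB (v i) b) := fun k l => by
  rw [lie_inB, slDiag_apply_basis, ← linB_apply, map_smul, LinearMap.smul_apply, linB_apply]

theorem hasWt_inC (i : Fin 3) (c : C) :
    D.HasWt v hV h3 (-wtU i) (D.inC (v.coord i) c) := fun k l => by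
  rw [lie_inC, coord_slDiag, ← linC_apply, map_smul, LinearMap.smul_apply, linC_apply, ← neg_smul]
  congr 1
  simp only [Pi.neg_apply]
  push_cast
  ring

/-- Each coordinate functional is itself an eigenvector for the diagonal matrices. Hence the
coordinates of a weight vector vanish in every slot whose weight is separated from its own. -/
theorem coordA_lie (k l i j : Fin 3) (z : L) :
    D.coordA v i j ⁅D.ι (slUnit hV h3 v k k - slUnit hV h3 v l l), z⁆ =
      ((wtE i j k - wtE i j l : ℤ) : F) • D.coordA v i j z := by
  have h : D.coordA v i j ∘ₗ
      (LieAlgebra.ad F L (D.ι (slUnit hV h3 v k k - slUnit hV h3 v l l)) : Module.End F L) =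
      ((wtE i j k - wtE i j l : ℤ) : F) • D.coordA v i j := by
    refine D.hom_ext (fun y a => ?_) (fun u b => ?_) (fun f c => ?_) (fun d => ?_) <;>
      simp only [LinearMap.comp_apply, LieAlgebra.ad_apply, LinearMap.smul_apply]
    · have h1 := LinearMap.congr_fun (coord_slDiag v hV h3 k l i) ((y : Module.End F V) (v j))
      rw [LinearMap.comp_apply, LinearMap.smul_apply] at h1
      rw [lie_inA, coordA_inA, coordA_inA, coe_lie_apply, map_sub, h1, slDiag_apply_basis, map_smul,
        map_smul, ← sub_smul, smul_smul, smul_eq_mul]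
      congr 1
      simp only [wtE, wtU]
      push_cast
      ring
    · simp [lie_inB, coordA]
    · simp [lie_inC, coordA]
    · simp [lie_coe, coordA]
  exact LinearMap.congr_fun h z

theorem coordB_lie (k l i : Fin 3) (z : L) :
    D.coordB v i ⁅D.ι (slUnit hV h3 v k k - slUnit hV h3 v l l), z⁆ =
      ((wtU i k - wtU i l : ℤ) : F) • D.coordB v i z := by
  have h : D.coordB v i ∘ₗ
      (LieAlgebra.ad F L (D.ι (slUnit hV h3 v k k - slUnit hV h3 v l l)) : Module.End F L) =
      ((wtU i k - wtU i l : ℤ) : F) • D.coordB v i := by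
    refine D.hom_ext (fun y a => ?_) (fun u b => ?_) (fun f c => ?_) (fun d => ?_) <;>
      simp only [LinearMap.comp_apply, LieAlgebra.ad_apply, LinearMap.smul_apply]
    · simp [lie_inA, coordB]
    · have h1 := LinearMap.congr_fun (coord_slDiag v hV h3 k l i) u
      rw [LinearMap.comp_apply, LinearMap.smul_apply] at h1
      rw [lie_inB, coordB_inB, coordB_inB, h1, smul_assoc]
    · simp [lie_inC, coordB]
    · simp [lie_coe, coordB]
  exact LinearMap.congr_fun h z

theorem coordC_lie (k l i : Fin 3) (z : L) :
    D.coordC v i ⁅D.ι (slUnit hV h3 v k k - slUnit hV h3 v l l), z⁆ =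
      (((-wtU i) k - (-wtU i) l : ℤ) : F) • D.coordC v i z := by
  have h : D.coordC v i ∘ₗ
      (LieAlgebra.ad F L (D.ι (slUnit hV h3 v k k - slUnit hV h3 v l l)) : Module.End F L) =
      (((-wtU i) k - (-wtU i) l : ℤ) : F) • D.coordC v i := by
    refine D.hom_ext (fun y a => ?_) (fun u b => ?_) (fun f c => ?_) (fun d => ?_) <;>
      simp only [LinearMap.comp_apply, LieAlgebra.ad_apply, LinearMap.smul_apply]
    · simp [lie_inA, coordC]
    · simp [lie_inB, coordC]
    · rw [lie_inC, map_neg, coordC_inC, coordC_inC, LinearMap.comp_apply, slDiag_apply_basis,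
        map_smul, smul_assoc, ← neg_smul]
      congr 1
      simp only [Pi.neg_apply]
      push_cast
      ring
    · simp [lie_coe, coordC]
  exact LinearMap.congr_fun h z

/-- The action of `𝔰𝔩(V)` preserves the three tensor summands and kills `𝔰`, so it never produces a
component in `𝔰`. -/
theorem projS_lie (x : sl F V) (z : L) : D.projS ⁅D.ι x, z⁆ = 0 := by
  have h : D.projS ∘ₗ (LieAlgebra.ad F L (D.ι x) : Module.End F L) = 0 := by
    refine D.hom_ext (fun y a => ?_) (fun u b => ?_) (fun f c => ?_) (fun d => ?_) <;>
      simp [lie_inA, lie_inB, lie_inC, lie_coe]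
  exact LinearMap.congr_fun h z

/-! ### Locating a weight vector in the decomposition. -/

section Vanishing

variable {D v hV h3} (h2 : (2 : F) ≠ 0) {w w' : Fin 3 → ℤ} {z : L}

include h2 in
-- The value `φ z` is scaled both by `w` and by `w'`, so it is annihilated by their difference; two
-- simple coroots suffice for the conclusion.
theorem HasWt.apply_eq_zero (hz : D.HasWt v hV h3 w z) (hs : WtSep w w') {W : Type*}
    [AddCommGroup W] [Module F W] (φ : L →ₗ[F] W)
    (hφ : ∀ k l, φ ⁅D.ι (slUnit hV h3 v k k - slUnit hV h3 v l l), z⁆ =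
      ((w' k - w' l : ℤ) : F) • φ z) : φ z = 0 := by
  have h : ∀ k l, ((w k - w l - (w' k - w' l) : ℤ) : F) • φ z = 0 := fun k l => by
    have := hφ k l
    rw [hz k l, map_smul] at this
    rw [Int.cast_sub, sub_smul, this, sub_self]
  exact eq_zero_of_gcd_dvd h2 h3 hs (h 0 1) (h 1 2)

include h2 in
theorem HasWt.eq_zero (hz : D.HasWt v hV h3 w z) (hA : ∀ i j, WtSep w (wtE i j))
    (hB : ∀ i, WtSep w (wtU i)) (hC : ∀ i, WtSep w (-wtU i)) : z = 0 := by
  -- `wtE 0 0` is the zero weight, which is the weight of `𝔰`.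
  have hS : D.projS z = 0 := hz.apply_eq_zero h2 (w' := wtE 0 0) (hA 0 0) _ fun k l => by
    rw [projS_lie]
    simp [wtE]
  rw [D.eq_sum_coord v hV h3 z, hS]
  simp only [hz.apply_eq_zero h2 (hA _ _) _ fun k l => D.coordA_lie v hV h3 k l _ _ z,
    hz.apply_eq_zero h2 (hB _) _ fun k l => D.coordB_lie v hV h3 k l _ z,
    hz.apply_eq_zero h2 (hC _) _ fun k l => D.coordC_lie v hV h3 k l _ z,
    ← linA_apply, ← linB_apply, ← linC_apply, map_zero, Finset.sum_const_zero, add_zero]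
  exact add_zero _

include h2 in
-- A root is separated from 0, from the other roots and from the weights of `V` and `V*`, so a
-- single coordinate survives. The separations are a finite check.
theorem HasWt.eq_inA {i j : Fin 3} (hz : D.HasWt v hV h3 (wtE i j) z) (hij : i ≠ j) :
    z = D.inA (slUnit hV h3 v i j) (D.coordA v i j z) := by
  have e1 : ∀ i j : Fin 3, i ≠ j → ∀ k l, ¬ (k = i ∧ l = j) → WtSep (wtE i j) (wtE k l) := by
    decide
  have e2 : ∀ i j : Fin 3, i ≠ j → ∀ k, WtSep (wtE i j) (wtU k) := by decide
  have e3 : ∀ i j : Fin 3, i ≠ j → ∀ k, WtSep (wtE i j) (-wtU k) := by decide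
  have hS : D.projS z = 0 := hz.apply_eq_zero h2 (w' := wtE i i)
    (e1 i j hij i i (by tauto)) _ fun k l => by
    rw [projS_lie]
    simp [wtE]
  have hA : ∀ k l, ¬ (k = i ∧ l = j) → D.coordA v k l z = 0 := fun k l hkl =>
    hz.apply_eq_zero h2 (e1 i j hij k l hkl) _ fun k' l' => D.coordA_lie v hV h3 k' l' k l z
  conv_lhs => rw [D.eq_sum_coord v hV h3 z, hS]
  rw [Finset.sum_eq_single i, Finset.sum_eq_single j]
  · simp only [hz.apply_eq_zero h2 (e2 i j hij _) _ fun k l => D.coordB_lie v hV h3 k l _ z,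
      hz.apply_eq_zero h2 (e3 i j hij _) _ fun k l => D.coordC_lie v hV h3 k l _ z,
      ← linA_apply, ← linB_apply, ← linC_apply, map_zero, Finset.sum_const_zero, add_zero]
    exact add_zero _
  · intro l _ hl
    rw [hA i l (by tauto), ← linA_apply, map_zero]
  · simp
  · intro k _ hk
    refine Finset.sum_eq_zero fun l _ => ?_
    rw [hA k l (by tauto), ← linA_apply, map_zero]
  · simp

include h2 in
theorem HasWt.eq_inB {i : Fin 3} (hz : D.HasWt v hV h3 (wtU i) z) :
    z = D.inB (v i) (D.coordB v i z) := by
  have e1 : ∀ i k l : Fin 3, WtSep (wtU i) (wtE k l) := by decide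
  have e2 : ∀ i k : Fin 3, k ≠ i → WtSep (wtU i) (wtU k) := by decide
  have e3 : ∀ i k : Fin 3, WtSep (wtU i) (-wtU k) := by decide
  have hS : D.projS z = 0 := hz.apply_eq_zero h2 (w' := wtE i i) (e1 i i i) _ fun k l => by
    rw [projS_lie]
    simp [wtE]
  have hB : ∀ k, k ≠ i → D.coordB v k z = 0 := fun k hk =>
    hz.apply_eq_zero h2 (e2 i k hk) _ fun k' l' => D.coordB_lie v hV h3 k' l' k z
  conv_lhs => rw [D.eq_sum_coord v hV h3 z, hS]
  rw [Finset.sum_eq_single (s := Finset.univ) (f := fun k => D.inB (v k) (D.coordB v k z)) i]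
  · simp only [hz.apply_eq_zero h2 (e1 i _ _) _ fun k' l' => D.coordA_lie v hV h3 k' l' _ _ z,
      hz.apply_eq_zero h2 (e3 i _) _ fun k l => D.coordC_lie v hV h3 k l _ z,
      ← linA_apply, ← linB_apply, ← linC_apply, map_zero, Finset.sum_const_zero, add_zero, zero_add]
    exact add_zero _
  · intro k _ hk
    rw [hB k hk, ← linB_apply, map_zero]
  · simp

include h2 in
theorem HasWt.eq_inC {i : Fin 3} (hz : D.HasWt v hV h3 (-wtU i) z) :
    z = D.inC (v.coord i) (D.coordC v i z) := by
  have e1 : ∀ i k l : Fin 3, WtSep (-wtU i) (wtE k l) := by decide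
  have e2 : ∀ i k : Fin 3, WtSep (-wtU i) (wtU k) := by decide
  have e3 : ∀ i k : Fin 3, k ≠ i → WtSep (-wtU i) (-wtU k) := by decide
  have hS : D.projS z = 0 := hz.apply_eq_zero h2 (w' := wtE i i) (e1 i i i) _ fun k l => by
    rw [projS_lie]
    simp [wtE]
  have hC : ∀ k, k ≠ i → D.coordC v k z = 0 := fun k hk =>
    hz.apply_eq_zero h2 (e3 i k hk) _ fun k' l' => D.coordC_lie v hV h3 k' l' k z
  conv_lhs => rw [D.eq_sum_coord v hV h3 z, hS]
  rw [Finset.sum_eq_single (s := Finset.univ)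
    (f := fun k => D.inC (v.coord k) (D.coordC v k z)) i]
  · simp only [hz.apply_eq_zero h2 (e1 i _ _) _ fun k' l' => D.coordA_lie v hV h3 k' l' _ _ z,
      hz.apply_eq_zero h2 (e2 i _) _ fun k l => D.coordB_lie v hV h3 k l _ z,
      ← linA_apply, ← linB_apply, ← linC_apply, map_zero, Finset.sum_const_zero, add_zero, zero_add]
    exact add_zero _
  · intro k _ hk
    rw [hC k hk, ← linC_apply, map_zero]
  · simp

end Vanishing

end Decomposition

/-! ### Independence of indices in a set of three. -/

section FinThree

/-- Replacing one index of an ordered pair by the third index connects all six pairs of distinct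
indices. -/
theorem eq_of_swap_indices {X : Type*} {a : Fin 3 → Fin 3 → X}
    (h₁ : ∀ i j k, i ≠ j → i ≠ k → j ≠ k → a k j = a i j)
    (h₂ : ∀ i j k, i ≠ j → i ≠ k → j ≠ k → a i k = a i j) (i j : Fin 3) (hij : i ≠ j) :
    a i j = a 0 1 := by
  have e20 : a 2 1 = a 0 1 := h₁ 0 1 2 (by decide) (by decide) (by decide)
  have e02 : a 0 2 = a 0 1 := h₂ 0 1 2 (by decide) (by decide) (by decide)
  have e21 : a 2 0 = a 2 1 := h₂ 2 1 0 (by decide) (by decide) (by decide)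
  have e10 : a 1 0 = a 2 0 := h₁ 2 0 1 (by decide) (by decide) (by decide)
  have e12 : a 1 2 = a 0 2 := h₁ 0 2 1 (by decide) (by decide) (by decide)
  fin_cases i <;> fin_cases j <;> simp_all

/-- Two transpositions generate the symmetric group on three letters. -/
theorem eq_of_swap_triples {X : Type*} {p : Fin 3 → Fin 3 → Fin 3 → X}
    (h₁ : ∀ i j k, i ≠ j → i ≠ k → j ≠ k → p i j k = p k j i)
    (h₂ : ∀ i j k, i ≠ j → i ≠ k → j ≠ k → p i j k = p i k j)
    (i j k : Fin 3) (hij : i ≠ j) (hik : i ≠ k) (hjk : j ≠ k) : p i j k = p 0 1 2 := by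
  have e1 : p 0 1 2 = p 2 1 0 := h₁ 0 1 2 (by decide) (by decide) (by decide)
  have e2 : p 0 1 2 = p 0 2 1 := h₂ 0 1 2 (by decide) (by decide) (by decide)
  have e3 : p 0 2 1 = p 1 2 0 := h₁ 0 2 1 (by decide) (by decide) (by decide)
  have e4 : p 2 1 0 = p 2 0 1 := h₂ 2 1 0 (by decide) (by decide) (by decide)
  have e5 : p 2 0 1 = p 1 0 2 := h₁ 2 0 1 (by decide) (by decide) (by decide)
  fin_cases i <;> fin_cases j <;> fin_cases k <;>
    first
    | exact absurd rfl hij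
    | exact absurd rfl hik
    | exact absurd rfl hjk
    | exact rfl
    | exact e1.symm
    | exact e2.symm
    | exact (e2.trans e3).symm
    | exact (e1.trans e4).symm
    | exact (e1.trans (e4.trans e5)).symm

theorem exists_third (i j : Fin 3) : ∃ k, i ≠ k ∧ j ≠ k := by
  revert i j
  decide

end FinThree

section LieBil

variable {F L M N W : Type*} [Field F] [LieRing L] [LieAlgebra F L] [AddCommGroup M] [Module F M]
  [AddCommGroup N] [Module F N] [AddCommGroup W] [Module F W]

/-- The bilinear map obtained from the bracket and from linear maps to and from `L`. -/
def lieBil (f : M →ₗ[F] L) (g : N →ₗ[F] L) (φ : L →ₗ[F] W) : M →ₗ[F] N →ₗ[F] W :=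
  LinearMap.mk₂ F (fun x y => φ ⁅f x, g y⁆) (fun x x' y => by simp) (fun t x y => by simp)
    (fun x y y' => by simp) (fun t x y => by simp)

theorem lieBil_apply (f : M →ₗ[F] L) (g : N →ₗ[F] L) (φ : L →ₗ[F] W) (x : M) (y : N) :
    lieBil f g φ x y = φ ⁅f x, g y⁆ := rfl

end LieBil

/-! ### Equivariant maps from `𝔰𝔩(V)`, `V` and `V*` to `L`. -/

namespace Decomposition

variable {F : Type*} [Field F] {V : Type*} [AddCommGroup V] [Module F V]
  {L : Type*} [LieRing L] [LieAlgebra F L] {A B C : Type*} [AddCommGroup A] [Module F A]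
  [AddCommGroup B] [Module F B] [AddCommGroup C] [Module F C]
  (D : Decomposition F V L A B C)
  (v : Module.Basis (Fin 3) F V) (hV : Module.finrank F V = 3) (h3 : (3 : F) ≠ 0)

local notation "E" => slUnit hV h3 v

section Linearity

variable (x y : sl F V) (a a' : A) (u : V) (b : B) (f : Module.Dual F V) (c : C) (t : F)

@[simp] theorem inA_zero : D.inA x 0 = 0 := map_zero (D.linA x)
@[simp] theorem zero_inA : D.inA 0 a = 0 := LinearMap.congr_fun (map_zero D.linA) a
theorem inA_add : D.inA x (a + a') = D.inA x a + D.inA x a' := map_add (D.linA x) a a'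
theorem inA_sub : D.inA x (a - a') = D.inA x a - D.inA x a' := map_sub (D.linA x) a a'
theorem inA_smul : D.inA x (t • a) = t • D.inA x a := map_smul (D.linA x) t a
theorem inA_neg : D.inA x (-a) = -D.inA x a := map_neg (D.linA x) a
theorem add_inA : D.inA (x + y) a = D.inA x a + D.inA y a :=
  LinearMap.congr_fun (map_add D.linA x y) a
theorem sub_inA : D.inA (x - y) a = D.inA x a - D.inA y a :=
  LinearMap.congr_fun (map_sub D.linA x y) a
theorem neg_inA : D.inA (-x) a = -D.inA x a := LinearMap.congr_fun (map_neg D.linA x) a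
@[simp] theorem inB_zero : D.inB u 0 = 0 := map_zero (D.linB u)
@[simp] theorem zero_inB : D.inB 0 b = 0 := LinearMap.congr_fun (map_zero D.linB) b
@[simp] theorem inC_zero : D.inC f 0 = 0 := map_zero (D.linC f)
@[simp] theorem zero_inC : D.inC 0 c = 0 := LinearMap.congr_fun (map_zero D.linC) c
theorem neg_inC : D.inC (-f) c = -D.inC f c := LinearMap.congr_fun (map_neg D.linC f) c
theorem neg_inB : D.inB (-u) b = -D.inB u b := LinearMap.congr_fun (map_neg D.linB u) b

end Linearity

theorem lie_unit_inA (i j k l : Fin 3) (a : A) :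
    ⁅D.ι (E i j), D.inA (E k l) a⁆ =
      (if j = k then D.inA (E i l) a else 0) - (if i = l then D.inA (E k j) a else 0) := by
  rw [lie_inA, lie_slUnit, sub_inA]
  split_ifs <;> simp

theorem lie_unit_inB (i j k : Fin 3) (hij : i ≠ j) (b : B) :
    ⁅D.ι (E i j), D.inB (v k) b⁆ = if j = k then D.inB (v i) b else 0 := by
  rw [lie_inB, coe_slUnit_apply_basis, if_neg hij, sub_zero]
  split_ifs <;> simp

theorem lie_unit_inC (i j k : Fin 3) (hij : i ≠ j) (c : C) :
    ⁅D.ι (E i j), D.inC (v.coord k) c⁆ = if i = k then -D.inC (v.coord j) c else 0 := by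
  rw [lie_inC, coord_comp_slUnit, if_neg hij, sub_zero]
  split_ifs <;> simp

theorem inA_unit_injective (i j : Fin 3) (hij : i ≠ j) :
    Function.Injective (D.inA (E i j)) := fun a a' h => by
  have := congrArg (D.coordA v i j) h
  simpa [coe_slUnit_apply_basis, hij] using this

theorem inB_basis_injective (i : Fin 3) : Function.Injective (D.inB (v i)) := fun b b' h => by
  have := congrArg (D.coordB v i) h
  simpa using this

theorem inC_basis_injective (i : Fin 3) : Function.Injective (D.inC (v.coord i)) :=
  fun c c' h => by
    have := congrArg (D.coordC v i) h
    simpa using this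

/-- An element annihilated by the root elements of `𝔰𝔩(V)` lies in `𝔰`. -/
theorem eq_projS {z : L} (h : ∀ i j, i ≠ j → ⁅D.ι (E i j), z⁆ = 0) : z = (D.projS z : L) := by
  have key : (LieAlgebra.ad F L : L →ₗ[F] Module.End F L).flip z ∘ₗ (D.ι : sl F V →ₗ[F] L) = 0 := by
    refine sl_hom_ext hV h3 v (fun i j hij => ?_) fun i j hij => ?_
    · simpa using h i j hij
    · have h1 := h i j hij
      have h2 := h j i hij.symm
      simp [h1, h2]
  have hz : z ∈ D.s := fun x => LinearMap.congr_fun key x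
  have := D.projS_coe ⟨z, hz⟩
  exact (congrArg (fun d : D.s => (d : L)) this).symm

section Homs

variable (h2 : (2 : F) ≠ 0)
include h2

/-- A form of Schur's lemma: weights force `φ (E i j) = E i j ⊗ a` with `a` depending on `i, j` at
first, and the action of root elements makes `a` constant. It yields both the unit of `A` and the
representation of `𝔰` on `A`. -/
theorem eq_inA_of_equivariant (φ : sl F V →ₗ[F] L) (hφ : ∀ x y, ⁅D.ι x, φ y⁆ = φ ⁅x, y⁆)
    (x : sl F V) : φ x = D.inA x (D.coordA v 0 1 (φ (E 0 1))) := by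
  have hr : ∀ i j, i ≠ j → φ (E i j) = D.inA (E i j) (D.coordA v i j (φ (E i j))) := by
    intro i j hij
    have hw : D.HasWt v hV h3 (wtE i j) (φ (E i j)) := fun k l => by
      rw [hφ, lie_slDiag_slUnit, map_smul]
    exact hw.eq_inA h2 hij
  have hc := eq_of_swap_indices (a := fun i j => D.coordA v i j (φ (E i j)))
    -- Applying `E k i` changes the first index from `i` to `k`; below, `E j k` changes the second
    -- from `j` to `k`, with the same sign on both sides.
    (fun i j k hij hik hjk => by
      have h := congrArg (fun z => ⁅D.ι (E k i), z⁆) (hr i j hij)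
      simp only [hφ, lie_slUnit, lie_unit_inA, if_true, if_neg hjk.symm, sub_zero] at h
      rw [hr k j hjk.symm] at h
      exact D.inA_unit_injective v hV h3 k j hjk.symm h)
    (fun i j k hij hik hjk => by
      have h := congrArg (fun z => ⁅D.ι (E j k), z⁆) (hr i j hij)
      simp only [hφ, lie_slUnit, lie_unit_inA, if_true, if_neg hik.symm, zero_sub, map_neg,
        neg_inj] at h
      rw [hr i k hik] at h
      exact D.inA_unit_injective v hV h3 i k hik h)
  have hr' : ∀ i j, i ≠ j → φ (E i j) = D.inA (E i j) (D.coordA v 0 1 (φ (E 0 1))) := by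
    intro i j hij
    rw [hr i j hij]
    exact congrArg _ (hc i j hij)
  have key : φ = D.linA.flip (D.coordA v 0 1 (φ (E 0 1))) := by
    refine sl_hom_ext hV h3 v hr' fun i j hij => ?_
    rw [← hφ, hr' j i hij.symm, lie_inA]
    rfl
  exact LinearMap.congr_fun key x

include hV h3 in
theorem eq_inB_of_equivariant (φ : V →ₗ[F] L)
    (hφ : ∀ (x : sl F V) u, ⁅D.ι x, φ u⁆ = φ ((x : Module.End F V) u))
    (u : V) : φ u = D.inB u (D.coordB v 0 (φ (v 0))) := by
  have hr : ∀ i, φ (v i) = D.inB (v i) (D.coordB v i (φ (v i))) := by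
    intro i
    have hw : D.HasWt v hV h3 (wtU i) (φ (v i)) := fun k l => by
      rw [hφ, slDiag_apply_basis, map_smul]
    exact hw.eq_inB h2
  have hc : ∀ i, φ (v i) = D.inB (v i) (D.coordB v 0 (φ (v 0))) := by
    intro i
    by_cases hi : i = 0
    · subst hi
      exact hr 0
    · have h := congrArg (fun z => ⁅D.ι (E i 0), z⁆) (hr 0)
      simpa only [hφ, coe_slUnit_apply_basis, D.lie_unit_inB v hV h3 i 0 0 hi, if_true,
        if_neg hi, sub_zero] using h
  have key : φ = D.linB.flip (D.coordB v 0 (φ (v 0))) := v.ext hc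
  exact LinearMap.congr_fun key u

include hV h3 in
theorem eq_inC_of_equivariant (φ : Module.Dual F V →ₗ[F] L)
    (hφ : ∀ (x : sl F V) f, ⁅D.ι x, φ f⁆ = -φ (f ∘ₗ (x : Module.End F V)))
    (f : Module.Dual F V) : φ f = D.inC f (D.coordC v 0 (φ (v.coord 0))) := by
  have hr : ∀ i, φ (v.coord i) = D.inC (v.coord i) (D.coordC v i (φ (v.coord i))) := by
    intro i
    have hw : D.HasWt v hV h3 (-wtU i) (φ (v.coord i)) := fun k l => by
      rw [hφ, coord_slDiag, map_smul, ← neg_smul]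
      congr 1
      simp only [Pi.neg_apply]
      push_cast
      ring
    exact hw.eq_inC h2
  have hc : ∀ i, φ (v.coord i) = D.inC (v.coord i) (D.coordC v 0 (φ (v.coord 0))) := by
    intro i
    by_cases hi : i = 0
    · subst hi
      exact hr 0
    · have h := congrArg (fun z => ⁅D.ι (E 0 i), z⁆) (hr 0)
      simpa only [hφ, coord_comp_slUnit, D.lie_unit_inC v hV h3 0 i 0 (Ne.symm hi), if_true,
        if_neg (Ne.symm hi), sub_zero, neg_inj] using h
  have key : φ = D.linC.flip (D.coordC v 0 (φ (v.coord 0))) := by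
    have : Module.Finite F V := Module.Finite.of_basis v
    refine v.dualBasis.ext fun i => ?_
    have e : v.dualBasis i = v.coord i := by
      rw [v.coe_dualBasis]
    rw [e]
    exact hc i
  exact LinearMap.congr_fun key f

end Homs

end Decomposition

/-! ### Coordinate maps read off from a basis; brackets with `𝔰` and brackets between different
summands. -/

namespace Decomposition

variable {F : Type*} [Field F] {V : Type*} [AddCommGroup V] [Module F V]
  {L : Type*} [LieRing L] [LieAlgebra F L] {A B C : Type*} [AddCommGroup A] [Module F A]
  [AddCommGroup B] [Module F B] [AddCommGroup C] [Module F C]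
  (D : Decomposition F V L A B C)
  (v : Module.Basis (Fin 3) F V) (hV : Module.finrank F V = 3) (h3 : (3 : F) ≠ 0)

local notation "E" => slUnit hV h3 v

/-- The product `a b`, from a basis. -/
noncomputable def mapAB : A →ₗ[F] B →ₗ[F] B :=
  lieBil (D.linA (E 0 1)) (D.linB (v 1)) (D.coordB v 0)

/-- The product `c a`, from a basis. -/
noncomputable def mapCA : C →ₗ[F] A →ₗ[F] C :=
  lieBil (D.linC (v.coord 0)) (D.linA (E 0 1)) (D.coordC v 1)

/-- The map `T (b, c)`, from a basis. -/
noncomputable def mapT : B →ₗ[F] C →ₗ[F] A :=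
  lieBil (D.linB (v 0)) (D.linC (v.coord 1)) (D.coordA v 0 1)

/-- The map `D_{b, c}`, from a basis. -/
noncomputable def mapDBC : B →ₗ[F] C →ₗ[F] D.s :=
  (3 : F) • lieBil (D.linB (v 0)) (D.linC (v.coord 0)) D.projS

/-- The map `b × b'`, from a basis. -/
noncomputable def mapBB : B →ₗ[F] B →ₗ[F] C :=
  lieBil (D.linB (v 0)) (D.linB (v 1)) (D.coordC v 2)

/-- The map `c × c'`, from a basis. -/
noncomputable def mapCC : C →ₗ[F] C →ₗ[F] B :=
  lieBil (D.linC (v.coord 0)) (D.linC (v.coord 1)) (D.coordB v 2)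

/-- The product `a a'`, from a basis. -/
noncomputable def mapAA : A →ₗ[F] A →ₗ[F] A :=
  lieBil (D.linA (E 0 1)) (D.linA (E 1 2)) (D.coordA v 0 2)

/-- The map `D_{a, a'}`, from a basis. -/
noncomputable def mapDAA : A →ₗ[F] A →ₗ[F] D.s :=
  (3 : F) • lieBil (D.linA (E 0 1)) (D.linA (E 1 0)) D.projS

/-- The representation of `𝔰` on `A`, from a basis. -/
noncomputable def mapSA : D.s →ₗ[F] A →ₗ[F] A :=
  lieBil (D.s.incl : D.s →ₗ[F] L) (D.linA (E 0 1)) (D.coordA v 0 1)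

/-- The representation of `𝔰` on `B`, from a basis. -/
noncomputable def mapSB : D.s →ₗ[F] B →ₗ[F] B :=
  lieBil (D.s.incl : D.s →ₗ[F] L) (D.linB (v 0)) (D.coordB v 0)

/-- The representation of `𝔰` on `C`, from a basis. -/
noncomputable def mapSC : D.s →ₗ[F] C →ₗ[F] C :=
  lieBil (D.s.incl : D.s →ₗ[F] L) (D.linC (v.coord 0)) (D.coordC v 0)

theorem lie_coe_swap (d : D.s) (x : sl F V) (z : L) :
    ⁅D.ι x, ⁅(d : L), z⁆⁆ = ⁅(d : L), ⁅D.ι x, z⁆⁆ := by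
  rw [leibniz_lie, lie_coe, zero_lie, zero_add]

section Brackets

variable (h2 : (2 : F) ≠ 0)
include h2

/-- Elements of `𝔰` commute with the image of `ι`, so their adjoint action is equivariant and can
only act on the coefficient. -/
theorem lie_coe_inA (d : D.s) (x : sl F V) (a : A) :
    ⁅(d : L), D.inA x a⁆ = D.inA x (D.mapSA v hV h3 d a) :=
  D.eq_inA_of_equivariant v hV h3 h2
    ((LieAlgebra.ad F L (d : L) : Module.End F L) ∘ₗ D.linA.flip a)
    (fun x y => by
      simp only [LinearMap.comp_apply, LieAlgebra.ad_apply, LinearMap.flip_apply, linA_apply]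
      rw [lie_coe_swap, lie_inA]) x

include hV h3 in
theorem lie_coe_inB (d : D.s) (u : V) (b : B) :
    ⁅(d : L), D.inB u b⁆ = D.inB u (D.mapSB v d b) :=
  D.eq_inB_of_equivariant v hV h3 h2
    ((LieAlgebra.ad F L (d : L) : Module.End F L) ∘ₗ D.linB.flip b)
    (fun x y => by
      simp only [LinearMap.comp_apply, LieAlgebra.ad_apply, LinearMap.flip_apply, linB_apply]
      rw [lie_coe_swap, lie_inB]) u

include hV h3 in
theorem lie_coe_inC (d : D.s) (f : Module.Dual F V) (c : C) :
    ⁅(d : L), D.inC f c⁆ = D.inC f (D.mapSC v d c) :=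
  D.eq_inC_of_equivariant v hV h3 h2
    ((LieAlgebra.ad F L (d : L) : Module.End F L) ∘ₗ D.linC.flip c)
    (fun x y => by
      simp only [LinearMap.comp_apply, LieAlgebra.ad_apply, LinearMap.flip_apply, linC_apply]
      rw [lie_coe_swap, lie_inC, lie_neg]) f

theorem lie_inA_inB_of_ne (i j k : Fin 3) (hij : i ≠ j) (hjk : j ≠ k) (a : A) (b : B) :
    ⁅D.inA (E i j) a, D.inB (v k) b⁆ = 0 := by
  have e1 : ∀ i j k : Fin 3, i ≠ j → j ≠ k → ∀ p q, WtSep (wtE i j + wtU k) (wtE p q) := by decide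
  have e2 : ∀ i j k : Fin 3, i ≠ j → j ≠ k → ∀ p, WtSep (wtE i j + wtU k) (wtU p) := by decide
  have e3 : ∀ i j k : Fin 3, i ≠ j → j ≠ k → ∀ p, WtSep (wtE i j + wtU k) (-wtU p) := by decide
  exact ((D.hasWt_inA v hV h3 i j a).lie (D.hasWt_inB v hV h3 k b)).eq_zero h2
    (e1 i j k hij hjk) (e2 i j k hij hjk) (e3 i j k hij hjk)

/-- The total weight is that of `v i`, so the bracket is `v i ⊗` something; moving the indices with
root elements identifies that coefficient for all pairs. -/
theorem lie_inA_inB_unit (i j : Fin 3) (hij : i ≠ j) (a : A) (b : B) :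
    ⁅D.inA (E i j) a, D.inB (v j) b⁆ = D.inB (v i) (D.mapAB v hV h3 a b) := by
  have hr : ∀ i j, i ≠ j → ⁅D.inA (E i j) a, D.inB (v j) b⁆ =
      D.inB (v i) (D.coordB v i ⁅D.inA (E i j) a, D.inB (v j) b⁆) := by
    intro i j hij
    have hw : ∀ i j k l : Fin 3, (wtE i j + wtU j) k - (wtE i j + wtU j) l = wtU i k - wtU i l := by
      decide
    exact (((D.hasWt_inA v hV h3 i j a).lie (D.hasWt_inB v hV h3 j b)).congr (hw i j)).eq_inB h2
  have hc := eq_of_swap_indices (a := fun i j => D.coordB v i ⁅D.inA (E i j) a, D.inB (v j) b⁆)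
    (fun i j k hij hik hjk => by
      have h := congrArg (fun z => ⁅D.ι (E k i), z⁆) (hr i j hij)
      simp only [leibniz_lie (D.ι (E k i)) (D.inA (E i j) a), lie_unit_inA,
        lie_unit_inB _ _ _ _ _ _ _ hik.symm, if_true, if_neg hjk.symm, if_neg hij, sub_zero,
        lie_zero, add_zero] at h
      rw [hr k j hjk.symm] at h
      exact D.inB_basis_injective v k h)
    -- The second index occurs in both factors. Applying `E j k` to the vanishing bracket of `E i j
    -- ⊗ a` with `v k ⊗ b` compares the middle indices `j` and `k`.
    (fun i j k hij hik hjk => by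
      have h := congrArg (fun z => ⁅D.ι (E j k), z⁆)
        (D.lie_inA_inB_of_ne v hV h3 h2 i j k hij hjk a b)
      simp only [leibniz_lie (D.ι (E j k)) (D.inA (E i j) a), lie_unit_inA,
        lie_unit_inB _ _ _ _ _ _ _ hjk, if_true, if_neg hik.symm, zero_sub, lie_zero,
        neg_lie] at h
      rw [hr i k hik, hr i j hij, neg_add_eq_zero] at h
      exact D.inB_basis_injective v i h)
  rw [hr i j hij]
  exact congrArg _ (hc i j hij)

theorem lie_inC_inA_of_ne (i j k : Fin 3) (hij : i ≠ j) (hik : i ≠ k) (a : A) (c : C) :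
    ⁅D.inC (v.coord k) c, D.inA (E i j) a⁆ = 0 := by
  have e1 : ∀ i j k : Fin 3, i ≠ j → i ≠ k → ∀ p q, WtSep (-wtU k + wtE i j) (wtE p q) := by decide
  have e2 : ∀ i j k : Fin 3, i ≠ j → i ≠ k → ∀ p, WtSep (-wtU k + wtE i j) (wtU p) := by decide
  have e3 : ∀ i j k : Fin 3, i ≠ j → i ≠ k → ∀ p, WtSep (-wtU k + wtE i j) (-wtU p) := by decide
  exact ((D.hasWt_inC v hV h3 k c).lie (D.hasWt_inA v hV h3 i j a)).eq_zero h2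
    (e1 i j k hij hik) (e2 i j k hij hik) (e3 i j k hij hik)

theorem lie_inC_inA_unit (i j : Fin 3) (hij : i ≠ j) (a : A) (c : C) :
    ⁅D.inC (v.coord i) c, D.inA (E i j) a⁆ = D.inC (v.coord j) (D.mapCA v hV h3 c a) := by
  have hr : ∀ i j, i ≠ j → ⁅D.inC (v.coord i) c, D.inA (E i j) a⁆ =
      D.inC (v.coord j) (D.coordC v j ⁅D.inC (v.coord i) c, D.inA (E i j) a⁆) := by
    intro i j hij
    have hw : ∀ i j k l : Fin 3,
        (-wtU i + wtE i j) k - (-wtU i + wtE i j) l = (-wtU j) k - (-wtU j) l := by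
      decide
    exact (((D.hasWt_inC v hV h3 i c).lie (D.hasWt_inA v hV h3 i j a)).congr (hw i j)).eq_inC h2
  have hc := eq_of_swap_indices
    (a := fun i j => D.coordC v j ⁅D.inC (v.coord i) c, D.inA (E i j) a⁆)
    (fun i j k hij hik hjk => by
      have h := congrArg (fun z => ⁅D.ι (E i k), z⁆)
        (D.lie_inC_inA_of_ne v hV h3 h2 k j i hjk.symm hik.symm a c)
      simp only [leibniz_lie (D.ι (E i k)) (D.inC (v.coord i) c), lie_unit_inA,
        lie_unit_inC _ _ _ _ _ _ _ hik, if_true, if_neg hij, sub_zero, lie_zero,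
        neg_lie] at h
      rw [hr i j hij, hr k j hjk.symm, neg_add_eq_zero] at h
      exact D.inC_basis_injective v j h)
    (fun i j k hij hik hjk => by
      have h := congrArg (fun z => ⁅D.ι (E j k), z⁆) (hr i j hij)
      simp only [leibniz_lie (D.ι (E j k)) (D.inC (v.coord i) c), lie_unit_inA,
        lie_unit_inC _ _ _ _ _ _ _ hjk, if_true, if_neg hik.symm, if_neg hij.symm, zero_sub,
        zero_lie, zero_add, lie_neg, neg_inj] at h
      rw [hr i k hik] at h
      exact D.inC_basis_injective v k h)
  rw [hr i j hij]
  exact congrArg _ (hc i j hij)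

theorem lie_inB_inC_unit (i j : Fin 3) (hij : i ≠ j) (b : B) (c : C) :
    ⁅D.inB (v i) b, D.inC (v.coord j) c⁆ = D.inA (E i j) (D.mapT v b c) := by
  have hr : ∀ i j, i ≠ j → ⁅D.inB (v i) b, D.inC (v.coord j) c⁆ =
      D.inA (E i j) (D.coordA v i j ⁅D.inB (v i) b, D.inC (v.coord j) c⁆) := by
    intro i j hij
    have hw : ∀ i j k l : Fin 3,
        (wtU i + -wtU j) k - (wtU i + -wtU j) l = wtE i j k - wtE i j l := by
      decide
    exact (((D.hasWt_inB v hV h3 i b).lie (D.hasWt_inC v hV h3 j c)).congr (hw i j)).eq_inA h2 hij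
  have hc := eq_of_swap_indices
    (a := fun i j => D.coordA v i j ⁅D.inB (v i) b, D.inC (v.coord j) c⁆)
    (fun i j k hij hik hjk => by
      have h := congrArg (fun z => ⁅D.ι (E k i), z⁆) (hr i j hij)
      simp only [leibniz_lie (D.ι (E k i)) (D.inB (v i) b), lie_unit_inA,
        lie_unit_inB _ _ _ _ _ _ _ hik.symm, lie_unit_inC _ _ _ _ _ _ _ hik.symm, if_true,
        if_neg hjk.symm, sub_zero, lie_zero, add_zero] at h
      rw [hr k j hjk.symm] at h
      exact D.inA_unit_injective v hV h3 k j hjk.symm h)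
    (fun i j k hij hik hjk => by
      have h := congrArg (fun z => ⁅D.ι (E j k), z⁆) (hr i j hij)
      simp only [leibniz_lie (D.ι (E j k)) (D.inB (v i) b), lie_unit_inA,
        lie_unit_inB _ _ _ _ _ _ _ hjk, lie_unit_inC _ _ _ _ _ _ _ hjk, if_true,
        if_neg hik.symm, zero_sub, zero_lie, zero_add, lie_neg, neg_inj] at h
      rw [hr i k hik] at h
      exact D.inA_unit_injective v hV h3 i k hik h)
  rw [hr i j hij]
  exact congrArg _ (hc i j hij)

/-- The total weight is 0, so weights alone do not determine the bracket. After subtraction of `E i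
i ⊗ T (b, c)`, the remainder `W i` is the same for all `i` and is killed by `E j k` when `j, k ≠ i`;
being independent of `i`, it is killed by every root element and lies in `𝔰`. -/
theorem lie_inB_inC_same (i : Fin 3) (b : B) (c : C) :
    ⁅D.inB (v i) b, D.inC (v.coord i) c⁆ =
      D.inA (E i i) (D.mapT v b c) + (1 / 3 : F) • (D.mapDBC v b c : L) := by
  set W : Fin 3 → L := fun i =>
    ⁅D.inB (v i) b, D.inC (v.coord i) c⁆ - D.inA (E i i) (D.mapT v b c) with hW
  have hc : ∀ i j, i ≠ j → W j = W i := by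
    intro i j hij
    have h := congrArg (fun z => ⁅D.ι (E j i), z⁆) (D.lie_inB_inC_unit v hV h3 h2 i j hij b c)
    simp only [leibniz_lie (D.ι (E j i)) (D.inB (v i) b), lie_unit_inA,
      lie_unit_inB _ _ _ _ _ _ _ hij.symm, lie_unit_inC _ _ _ _ _ _ _ hij.symm, if_true,
      lie_neg] at h
    simp only [hW]
    rw [sub_eq_sub_iff_add_eq_add, ← sub_eq_zero]
    rw [← sub_eq_zero] at h
    rw [← h]
    abel
  have hk : ∀ i j k, i ≠ j → i ≠ k → j ≠ k → ⁅D.ι (E j k), W i⁆ = 0 := by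
    intro i j k hij hik hjk
    simp only [hW]
    rw [lie_sub, leibniz_lie]
    simp only [lie_unit_inA, lie_unit_inB _ _ _ _ _ _ _ hjk, lie_unit_inC _ _ _ _ _ _ _ hjk,
      if_neg hij.symm, if_neg hik.symm, zero_lie, lie_zero, sub_zero, add_zero]
  have h0 : ∀ i, W i = W 0 := fun i => by
    by_cases hi : i = 0
    · rw [hi]
    · exact hc 0 i (Ne.symm hi)
  have hz : W 0 = (D.projS (W 0) : L) := D.eq_projS v hV h3 fun j k hjk => by
    obtain ⟨i, hji, hki⟩ := exists_third j k
    rw [← h0 i]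
    exact hk i j k hji.symm hki.symm hjk
  -- The factor 3 in `mapDBC` cancels the `1/3` with which `D_{b,c}` enters the bracket.
  have hD : (1 / 3 : F) • D.mapDBC v b c = D.projS (W 0) := by
    simp only [hW, mapDBC, map_sub, projS_inA, sub_zero, LinearMap.smul_apply, lieBil_apply,
      linB_apply, linC_apply, smul_smul]
    rw [one_div_mul_cancel h3, one_smul]
  have hD' := congrArg (fun d : D.s => (d : L)) hD
  have hi := (h0 i).trans (hz.trans hD'.symm)
  rw [← sub_eq_iff_eq_add']
  exact hi

end Brackets

end Decomposition

/-! ### Brackets of two weight vectors from the same summand. -/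

namespace Decomposition

variable {F : Type*} [Field F] {V : Type*} [AddCommGroup V] [Module F V]
  {L : Type*} [LieRing L] [LieAlgebra F L] {A B C : Type*} [AddCommGroup A] [Module F A]
  [AddCommGroup B] [Module F B] [AddCommGroup C] [Module F C]
  (D : Decomposition F V L A B C)
  (v : Module.Basis (Fin 3) F V) (hV : Module.finrank F V = 3) (h3 : (3 : F) ≠ 0)

local notation "E" => slUnit hV h3 v

theorem inA_diag_sub_injective (i j : Fin 3) (hij : i ≠ j) :
    Function.Injective (D.inA (E i i - E j j)) := fun a a' h => by
  have := congrArg (D.coordA v i i) h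
  simpa [coe_sub_apply, coe_slUnit_apply_basis, hij.symm] using this

/-- For products of root elements, `x` and `y` will be the two orders of matrix multiplication, so
that `x - y` is their bracket and, for a non-opposite pair, `x + y` their circle product; `p` and
`p'` are the two orders of multiplication in `A`. -/
theorem inA_half_add_half (h2 : (2 : F) ≠ 0) (x y : sl F V) (p p' : A) :
    D.inA (x - y) ((1 / 2 : F) • (p + p')) + D.inA (x + y) ((1 / 2 : F) • (p - p')) =
      D.inA x p - D.inA y p' := by
  simp only [sub_inA, add_inA, inA_smul, inA_add, inA_sub]
  match_scalars <;> field_simp <;> ring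

section Brackets

variable (h2 : (2 : F) ≠ 0)
include h2

include hV h3 in
theorem lie_inB_inB_same (i : Fin 3) (b b' : B) : ⁅D.inB (v i) b, D.inB (v i) b'⁆ = 0 := by
  have e1 : ∀ i p q : Fin 3, WtSep (wtU i + wtU i) (wtE p q) := by decide
  have e2 : ∀ i p : Fin 3, WtSep (wtU i + wtU i) (wtU p) := by decide
  have e3 : ∀ i p : Fin 3, WtSep (wtU i + wtU i) (-wtU p) := by decide
  exact ((D.hasWt_inB v hV h3 i b).lie (D.hasWt_inB v hV h3 i b')).eq_zero h2 (e1 i) (e2 i) (e3 i)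

include hV h3 in
theorem lie_inC_inC_same (i : Fin 3) (c c' : C) :
    ⁅D.inC (v.coord i) c, D.inC (v.coord i) c'⁆ = 0 := by
  have e1 : ∀ i p q : Fin 3, WtSep (-wtU i + -wtU i) (wtE p q) := by decide
  have e2 : ∀ i p : Fin 3, WtSep (-wtU i + -wtU i) (wtU p) := by decide
  have e3 : ∀ i p : Fin 3, WtSep (-wtU i + -wtU i) (-wtU p) := by decide
  exact ((D.hasWt_inC v hV h3 i c).lie (D.hasWt_inC v hV h3 i c')).eq_zero h2 (e1 i) (e2 i) (e3 i)

include hV h3 in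
-- Twice the weight of `v i` does not occur in `L`, so two elements along `v i` commute. Applying `E
-- j i` to that relation polarizes it, and this is the source of the symmetry of `b × b'`.
theorem lie_inB_inB_eq (i j : Fin 3) (hij : i ≠ j) (b b' : B) :
    ⁅D.inB (v i) b, D.inB (v j) b'⁆ = ⁅D.inB (v i) b', D.inB (v j) b⁆ := by
  have h := congrArg (fun z => ⁅D.ι (E j i), z⁆) (D.lie_inB_inB_same v hV h3 h2 i b b')
  simp only [leibniz_lie (D.ι (E j i)) (D.inB (v i) b), lie_unit_inB _ _ _ _ _ _ _ hij.symm,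
    if_true, lie_zero] at h
  rw [← lie_skew, neg_add_eq_zero] at h
  exact h.symm

include hV h3 in
theorem lie_inC_inC_eq (i j : Fin 3) (hij : i ≠ j) (c c' : C) :
    ⁅D.inC (v.coord i) c, D.inC (v.coord j) c'⁆ = ⁅D.inC (v.coord i) c', D.inC (v.coord j) c⁆ := by
  have h := congrArg (fun z => ⁅D.ι (E i j), z⁆) (D.lie_inC_inC_same v hV h3 h2 i c c')
  simp only [leibniz_lie (D.ι (E i j)) (D.inC (v.coord i) c), lie_unit_inC _ _ _ _ _ _ _ hij,
    if_true, lie_zero, neg_lie, lie_neg, lie_skew] at h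
  rw [← lie_skew (D.inC (v.coord j) c'), ← sub_eq_add_neg, sub_eq_zero] at h
  exact h.symm

include hV h3 in
-- Indices are taken modulo 3: `i, i + 1, i + 2` is an even arrangement, so no sign appears. The
-- operator `E (i + 2) i` passes from one cyclic pair to the next in reversed order; the sign from
-- skew-symmetry and the interchange of `b, b'` are absorbed by `lie_inB_inB_eq`.
theorem lie_inB_inB_next (i : Fin 3) (b b' : B) :
    ⁅D.inB (v i) b, D.inB (v (i + 1)) b'⁆ = D.inC (v.coord (i + 2)) (D.mapBB v b b') := by
  have hr : ∀ i b b', ⁅D.inB (v i) b, D.inB (v (i + 1)) b'⁆ =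
      D.inC (v.coord (i + 2)) (D.coordC v (i + 2) ⁅D.inB (v i) b, D.inB (v (i + 1)) b'⁆) := by
    intro i b b'
    have hw : ∀ i k l : Fin 3, (wtU i + wtU (i + 1)) k - (wtU i + wtU (i + 1)) l =
        (-wtU (i + 2)) k - (-wtU (i + 2)) l := by
      decide
    exact (((D.hasWt_inB v hV h3 i b).lie
      (D.hasWt_inB v hV h3 (i + 1) b')).congr (hw i)).eq_inC h2
  have hstep : ∀ i b b', D.coordC v (i + 2) ⁅D.inB (v i) b, D.inB (v (i + 1)) b'⁆ =
      D.coordC v (i + 1 + 2) ⁅D.inB (v (i + 1)) b, D.inB (v (i + 1 + 1)) b'⁆ := by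
    intro i b b'
    have h1 : i ≠ i + 1 := by revert i; decide
    have h3' : i + 2 ≠ i := by revert i; decide
    have h4 : i + 1 + 1 = i + 2 := by revert i; decide
    have h5 : i + 1 + 2 = i := by revert i; decide
    have h6 : i + 1 ≠ i + 2 := by revert i; decide
    rw [h4, h5]
    have h := congrArg (fun z => ⁅D.ι (E (i + 2) i), z⁆) (hr i b b')
    simp only [leibniz_lie (D.ι (E (i + 2) i)) (D.inB (v i) b), lie_unit_inB _ _ _ _ _ _ _ h3',
      lie_unit_inC _ _ _ _ _ _ _ h3', if_true, if_neg h1, lie_zero, add_zero] at h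
    rw [← lie_skew, neg_inj, D.lie_inB_inB_eq v hV h3 h2 _ _ h6] at h
    have h' := hr (i + 1) b b'
    rw [h4, h5] at h'
    rw [h'] at h
    exact (D.inC_basis_injective v i h).symm
  rw [hr]
  congr 1
  have e2 : ∀ i : Fin 3, D.coordC v (i + 2) ⁅D.inB (v i) b, D.inB (v (i + 1)) b'⁆ =
      D.coordC v (0 + 2) ⁅D.inB (v 0) b, D.inB (v (0 + 1)) b'⁆ := by
    intro i
    fin_cases i
    · rfl
    · exact (hstep 0 b b').symm
    · exact (hstep 1 b b').symm.trans (hstep 0 b b').symm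
  exact e2 i

include hV h3 in
theorem lie_inC_inC_next (i : Fin 3) (c c' : C) :
    ⁅D.inC (v.coord i) c, D.inC (v.coord (i + 1)) c'⁆ = D.inB (v (i + 2)) (D.mapCC v c c') := by
  have hr : ∀ i c c', ⁅D.inC (v.coord i) c, D.inC (v.coord (i + 1)) c'⁆ =
      D.inB (v (i + 2))
        (D.coordB v (i + 2) ⁅D.inC (v.coord i) c, D.inC (v.coord (i + 1)) c'⁆) := by
    intro i c c'
    have hw : ∀ i k l : Fin 3, (-wtU i + -wtU (i + 1)) k - (-wtU i + -wtU (i + 1)) l =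
        (wtU (i + 2)) k - (wtU (i + 2)) l := by
      decide
    exact (((D.hasWt_inC v hV h3 i c).lie
      (D.hasWt_inC v hV h3 (i + 1) c')).congr (hw i)).eq_inB h2
  have hstep : ∀ i c c', D.coordB v (i + 2) ⁅D.inC (v.coord i) c, D.inC (v.coord (i + 1)) c'⁆ =
      D.coordB v (i + 1 + 2) ⁅D.inC (v.coord (i + 1)) c, D.inC (v.coord (i + 1 + 1)) c'⁆ := by
    intro i c c'
    have h1 : i ≠ i + 1 := by revert i; decide
    have h3' : i ≠ i + 2 := by revert i; decide
    have h4 : i + 1 + 1 = i + 2 := by revert i; decide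
    have h5 : i + 1 + 2 = i := by revert i; decide
    have h6 : i + 1 ≠ i + 2 := by revert i; decide
    rw [h4, h5]
    have h := congrArg (fun z => ⁅D.ι (E i (i + 2)), z⁆) (hr i c c')
    simp only [leibniz_lie (D.ι (E i (i + 2))) (D.inC (v.coord i) c),
      lie_unit_inC _ _ _ _ _ _ _ h3', lie_unit_inB _ _ _ _ _ _ _ h3', if_true, if_neg h1,
      lie_zero, add_zero, neg_lie, lie_skew] at h
    rw [D.lie_inC_inC_eq v hV h3 h2 _ _ h6] at h
    have h' := hr (i + 1) c c'
    rw [h4, h5] at h'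
    rw [h'] at h
    exact (D.inB_basis_injective v i h).symm
  rw [hr]
  congr 1
  have e2 : ∀ i : Fin 3, D.coordB v (i + 2) ⁅D.inC (v.coord i) c, D.inC (v.coord (i + 1)) c'⁆ =
      D.coordB v (0 + 2) ⁅D.inC (v.coord 0) c, D.inC (v.coord (0 + 1)) c'⁆ := by
    intro i
    fin_cases i
    · rfl
    · exact (hstep 0 c c').symm
    · exact (hstep 1 c c').symm.trans (hstep 0 c c').symm
  exact e2 i

include hV h3 in
theorem mapBB_symm (b b' : B) : D.mapBB v b b' = D.mapBB v b' b := by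
  refine D.inC_basis_injective v (0 + 2) ?_
  rw [← D.lie_inB_inB_next v hV h3 h2, ← D.lie_inB_inB_next v hV h3 h2]
  exact D.lie_inB_inB_eq v hV h3 h2 _ _ (by decide) b b'

include hV h3 in
theorem mapCC_symm (c c' : C) : D.mapCC v c c' = D.mapCC v c' c := by
  refine D.inB_basis_injective v (0 + 2) ?_
  rw [← D.lie_inC_inC_next v hV h3 h2, ← D.lie_inC_inC_next v hV h3 h2]
  exact D.lie_inC_inC_eq v hV h3 h2 _ _ (by decide) c c'

theorem lie_inA_inA_of_ne (i j k l : Fin 3) (hij : i ≠ j) (hkl : k ≠ l) (hjk : j ≠ k)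
    (hil : i ≠ l) (a a' : A) : ⁅D.inA (E i j) a, D.inA (E k l) a'⁆ = 0 := by
  have e1 : ∀ i j k l : Fin 3, i ≠ j → k ≠ l → j ≠ k → i ≠ l →
      (∀ p q, WtSep (wtE i j + wtE k l) (wtE p q)) ∧
      (∀ p, WtSep (wtE i j + wtE k l) (wtU p)) ∧ ∀ p, WtSep (wtE i j + wtE k l) (-wtU p) := by
    decide
  obtain ⟨e1, e2, e3⟩ := e1 i j k l hij hkl hjk hil
  exact ((D.hasWt_inA v hV h3 i j a).lie (D.hasWt_inA v hV h3 k l a')).eq_zero h2 e1 e2 e3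

/-- Multiplication of matrix units with three distinct indices defines the product of `A`; the
content is that it does not depend on which three. -/
theorem lie_inA_inA_unit (i j k : Fin 3) (hij : i ≠ j) (hik : i ≠ k) (hjk : j ≠ k) (a a' : A) :
    ⁅D.inA (E i j) a, D.inA (E j k) a'⁆ = D.inA (E i k) (D.mapAA v hV h3 a a') := by
  have hr : ∀ i j k, i ≠ j → i ≠ k → j ≠ k → ⁅D.inA (E i j) a, D.inA (E j k) a'⁆ =
      D.inA (E i k) (D.coordA v i k ⁅D.inA (E i j) a, D.inA (E j k) a'⁆) := by
    intro i j k hij hik hjk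
    have hw : ∀ i j k p q : Fin 3,
        (wtE i j + wtE j k) p - (wtE i j + wtE j k) q = wtE i k p - wtE i k q := by
      decide
    exact (((D.hasWt_inA v hV h3 i j a).lie
      (D.hasWt_inA v hV h3 j k a')).congr (hw i j k)).eq_inA h2 hik
  have hc := eq_of_swap_triples
    (p := fun i j k => D.coordA v i k ⁅D.inA (E i j) a, D.inA (E j k) a'⁆)
    -- Applying `E k i` to the triple `i, j, k` and `E i k` to the reversed triple gives opposite
    -- combinations of the same two brackets, so the diagonal coefficients agree.
    (fun i j k hij hik hjk => by
      have h := congrArg (fun z => ⁅D.ι (E k i), z⁆) (hr i j k hij hik hjk)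
      have h' := congrArg (fun z => ⁅D.ι (E i k), z⁆) (hr k j i hjk.symm hik.symm hij.symm)
      simp only [leibniz_lie (D.ι (E k i)) (D.inA (E i j) a), lie_unit_inA, if_true, if_neg hij,
        if_neg hjk.symm, sub_zero, zero_sub, lie_neg] at h
      simp only [leibniz_lie (D.ι (E i k)) (D.inA (E k j) a), lie_unit_inA, if_true, if_neg hij,
        if_neg hjk.symm, sub_zero, zero_sub, lie_neg] at h'
      refine D.inA_diag_sub_injective v hV h3 k i hik.symm ?_
      rw [sub_inA, sub_inA, ← h, ← neg_sub, ← h']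
      abel)
    -- Both computations evaluate the bracket of `E i j ⊗ a` with a diagonal element with
    -- coefficient `a'`: one from the triple `i, j, k`, the other from the vanishing bracket of `E i
    -- j ⊗ a` with `E k j ⊗ a'`.
    (fun i j k hij hik hjk => by
      have h := congrArg (fun z => ⁅D.ι (E k j), z⁆) (hr i j k hij hik hjk)
      have h' := congrArg (fun z => ⁅D.ι (E j k), z⁆)
        (D.lie_inA_inA_of_ne v hV h3 h2 i j k j hij hjk.symm hjk hij a a')
      simp only [leibniz_lie (D.ι (E k j)) (D.inA (E i j) a), lie_unit_inA, if_true,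
        if_neg hij.symm, zero_sub, lie_sub, zero_lie, sub_self, zero_add,
        if_neg hjk.symm] at h
      simp only [leibniz_lie (D.ι (E j k)) (D.inA (E i j) a), lie_unit_inA, if_true,
        if_neg hik.symm, zero_sub, neg_lie, lie_sub, lie_zero] at h'
      refine D.inA_unit_injective v hV h3 i j hij ?_
      rw [← neg_inj, ← h, ← hr i k j hik hij hjk.symm, ← sub_eq_zero, ← neg_eq_zero, ← h']
      abel)
  rw [hr i j k hij hik hjk]
  exact congrArg _ (hc i j k hij hik hjk)

/-- Applying `E k i` to the product of three distinct units shows that the remainder `W` does not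
change with the first index; skew-symmetry handles the second. As `W i j` is killed by `E i k` and
is independent of the pair, it is killed by all root elements, so it lies in `𝔰`. -/
theorem lie_inA_inA_opp (i j : Fin 3) (hij : i ≠ j) (a a' : A) :
    ⁅D.inA (E i j) a, D.inA (E j i) a'⁆ =
      D.inA (E i i) (D.mapAA v hV h3 a a') - D.inA (E j j) (D.mapAA v hV h3 a' a) +
        (1 / 3 : F) • (D.mapDAA v hV h3 a a' : L) := by
  set W : A → A → Fin 3 → Fin 3 → L := fun a a' i j => ⁅D.inA (E i j) a, D.inA (E j i) a'⁆ -
    (D.inA (E i i) (D.mapAA v hV h3 a a') - D.inA (E j j) (D.mapAA v hV h3 a' a)) with hW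
  have hswap : ∀ a a' i j, W a a' i j = -W a' a j i := by
    intro a a' i j
    simp only [hW]
    rw [← lie_skew]
    abel
  have h1 : ∀ a a' i j k, i ≠ j → i ≠ k → j ≠ k → W a a' k j = W a a' i j := by
    intro a a' i j k hij hik hjk
    have h := congrArg (fun z => ⁅D.ι (E k i), z⁆)
      (D.lie_inA_inA_unit v hV h3 h2 i j k hij hik hjk a a')
    simp only [leibniz_lie (D.ι (E k i)) (D.inA (E i j) a), lie_unit_inA, if_true, if_neg hij,
      if_neg hjk.symm, sub_zero, zero_sub, lie_neg] at h
    simp only [hW]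
    rw [← sub_eq_zero] at h ⊢
    rw [← h]
    abel
  have hc : W a a' i j = W a a' 0 1 := eq_of_swap_indices (a := W a a') (h1 a a')
    (fun i j k hij hik hjk => by
      rw [hswap, h1 a' a j i k hij.symm hjk hik, ← hswap]) i j hij
  have hc' : ∀ i j, i ≠ j → W a a' i j = W a a' 0 1 := eq_of_swap_indices (a := W a a') (h1 a a')
    (fun i j k hij hik hjk => by
      rw [hswap, h1 a' a j i k hij.symm hjk hik, ← hswap])
  have hk : ∀ i j k, i ≠ j → i ≠ k → j ≠ k → ⁅D.ι (E i k), W a a' i j⁆ = 0 := by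
    intro i j k hij hik hjk
    simp only [hW]
    rw [lie_sub, leibniz_lie]
    simp only [lie_unit_inA, lie_sub, if_true, if_neg hij, if_neg hik.symm,
      if_neg hjk.symm, zero_lie, sub_zero, zero_sub, lie_neg, zero_add,
      D.lie_inA_inA_unit v hV h3 h2 i j k hij hik hjk, sub_self]
  -- For a given root element `E i k`, the remainder is rewritten with `j` the third index.
  have hz : W a a' 0 1 = (D.projS (W a a' 0 1) : L) := D.eq_projS v hV h3 fun i k hik => by
    obtain ⟨j, hij, hkj⟩ := exists_third i k
    rw [← hc' i j hij]
    exact hk i j k hij hik hkj.symm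
  have hD : (1 / 3 : F) • D.mapDAA v hV h3 a a' = D.projS (W a a' 0 1) := by
    simp only [hW, mapDAA, map_sub, projS_inA, sub_zero, LinearMap.smul_apply, lieBil_apply,
      linA_apply, smul_smul]
    rw [one_div_mul_cancel h3, one_smul]
  have hD' := congrArg (fun d : D.s => (d : L)) hD
  have hi := hc.trans (hz.trans hD'.symm)
  rw [← sub_eq_iff_eq_add']
  exact hi

theorem mapDAA_skew (a a' : A) : D.mapDAA v hV h3 a a' = -D.mapDAA v hV h3 a' a := by
  have h := D.lie_inA_inA_opp v hV h3 h2 0 1 (by decide) a a'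
  rw [← lie_skew, D.lie_inA_inA_opp v hV h3 h2 1 0 (by decide) a' a] at h
  have h' : (1 / 3 : F) • (D.mapDAA v hV h3 a a' : L) =
      (1 / 3 : F) • -(D.mapDAA v hV h3 a' a : L) := by
    rw [← sub_eq_zero] at h ⊢
    rw [← neg_eq_zero, ← h]
    module
  have h'' := smul_right_injective L (one_div_ne_zero h3) h'
  exact Subtype.ext h''

include v hV h3 in
-- The embedding `ι` is itself an equivariant map.
theorem exists_one : ∃ one : A, ∀ x : sl F V, D.ι x = D.inA x one :=
  ⟨_, D.eq_inA_of_equivariant v hV h3 h2 D.ι fun x y => (LieHom.map_lie _ x y).symm⟩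

end Brackets

end Decomposition

/-! ### Wedge products, trace form and circle product on a basis. -/

section LinearAlgebra

variable {F : Type*} [Field F] {V : Type*} [AddCommGroup V] [Module F V]
  (hV : Module.finrank F V = 3) (h3 : (3 : F) ≠ 0) (v : Module.Basis (Fin 3) F V)

local notation "E" => slUnit hV h3 v

/-- The wedge product as a bilinear map. -/
def wedgeLin (det : V [⋀^Fin 3]→ₗ[F] F) : V →ₗ[F] V →ₗ[F] Module.Dual F V :=
  have k0 : ∀ z y w : V, Function.update ![0, y, w] 0 z = ![z, y, w] := fun z y w => by
    ext i
    fin_cases i <;> rfl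
  have k1 : ∀ z x w : V, Function.update ![x, 0, w] 1 z = ![x, z, w] := fun z x w => by
    ext i
    fin_cases i <;> rfl
  LinearMap.mk₂ F (wedge det)
    (fun x x' y => LinearMap.ext fun w => by
      change det ![x + x', y, w] = det ![x, y, w] + det ![x', y, w]
      rw [← k0 (x + x') y w, ← k0 x y w, ← k0 x' y w]
      exact det.map_update_add _ _ _ _)
    (fun t x y => LinearMap.ext fun w => by
      change det ![t • x, y, w] = t • det ![x, y, w]
      rw [← k0 (t • x) y w, ← k0 x y w]
      exact det.map_update_smul _ _ _ _)
    (fun x y y' => LinearMap.ext fun w => by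
      change det ![x, y + y', w] = det ![x, y, w] + det ![x, y', w]
      rw [← k1 (y + y') x w, ← k1 y x w, ← k1 y' x w]
      exact det.map_update_add _ _ _ _)
    (fun t x y => LinearMap.ext fun w => by
      change det ![x, t • y, w] = t • det ![x, y, w]
      rw [← k1 (t • y) x w, ← k1 y x w]
      exact det.map_update_smul _ _ _ _)

theorem wedge_self (det : V [⋀^Fin 3]→ₗ[F] F) (x : V) : wedge det x x = 0 :=
  LinearMap.ext fun w => det.map_eq_zero_of_eq _ (i := 0) (j := 1) rfl (by decide)

theorem wedge_swap (det : V [⋀^Fin 3]→ₗ[F] F) (x y : V) : wedge det x y = -wedge det y x := by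
  have h : (wedgeLin det).IsAlt := wedge_self det
  exact (h.neg y x).symm

/-- Translation by `i` on indices modulo 3 is an even permutation. -/
theorem wedge_basis_next (det : V [⋀^Fin 3]→ₗ[F] F) (hv : det v = 1) (i : Fin 3) :
    wedge det (v i) (v (i + 1)) = v.coord (i + 2) := by
  refine v.ext fun k => ?_
  change det ![v i, v (i + 1), v k] = _
  have hk : k = i ∨ k = i + 1 ∨ k = i + 2 := by revert i k; decide
  rcases hk with rfl | rfl | rfl
  · rw [det.map_eq_zero_of_eq _ (i := 0) (j := 2) rfl (by decide)]
    simp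
  · rw [det.map_eq_zero_of_eq _ (i := 1) (j := 2) rfl (by decide)]
    simp
  · have e : ![v i, v (i + 1), v (i + 2)] = v ∘ Equiv.addLeft i := by
      ext j
      fin_cases j <;> simp
    have hs : ∀ i : Fin 3, Equiv.Perm.sign (Equiv.addLeft i) = 1 := by decide
    rw [e, det.map_perm, hs, hv]
    simp

theorem detDual_coord (det : V [⋀^Fin 3]→ₗ[F] F) (hv : det v = 1) :
    detDual hV det v.coord = 1 := by
  have hdet : det ≠ 0 := by
    rintro rfl
    simp at hv
  have h := detDual_mul_det hV det hdet v.coord v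
  rw [hv, mul_one] at h
  rw [h]
  convert Matrix.det_one (n := Fin 3) (R := F)
  ext i j
  simp [Matrix.one_apply, Finsupp.single_apply, eq_comm]

/-- The wedge product of the dual space as a bilinear map. -/
noncomputable def wedgeDualLin [Module.Finite F V] (det : V [⋀^Fin 3]→ₗ[F] F) :
    Module.Dual F V →ₗ[F] Module.Dual F V →ₗ[F] V :=
  (wedgeLin (detDual hV det)).compr₂ (Module.evalEquiv F V).symm.toLinearMap

theorem wedgeDual_self [Module.Finite F V] (det : V [⋀^Fin 3]→ₗ[F] F) (f : Module.Dual F V) :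
    wedgeDual hV det f f = 0 := by
  rw [wedgeDual, wedge_self, map_zero]

theorem wedgeDual_swap [Module.Finite F V] (det : V [⋀^Fin 3]→ₗ[F] F) (f g : Module.Dual F V) :
    wedgeDual hV det f g = -wedgeDual hV det g f := by
  rw [wedgeDual, wedge_swap, map_neg]
  rfl

theorem wedgeDual_coord_next [Module.Finite F V] (det : V [⋀^Fin 3]→ₗ[F] F) (hv : det v = 1)
    (i : Fin 3) : wedgeDual hV det (v.coord i) (v.coord (i + 1)) = v (i + 2) := by
  have h := wedge_basis_next v.dualBasis (detDual hV det)
    (by rw [v.coe_dualBasis]; exact detDual_coord hV v det hv) i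
  rw [v.coe_dualBasis] at h
  rw [wedgeDual, h, LinearEquiv.symm_apply_eq]
  refine LinearMap.ext fun f => ?_
  simp [Module.Basis.coord_apply]

include hV in
theorem exists_basis_det_eq_one (det : V [⋀^Fin 3]→ₗ[F] F) (hdet : det ≠ 0) :
    ∃ v : Module.Basis (Fin 3) F V, det v = 1 := by
  have : Module.Finite F V := Module.finite_of_finrank_pos (by omega)
  set b := Module.finBasisOfFinrankEq F V hV
  have h1 : det = det b • b.det := AlternatingMap.eq_smul_basis_det b det
  have h0 : det b ≠ 0 := by
    intro h
    rw [h, zero_smul] at h1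
    exact hdet h1
  set w : Fin 3 → Fˣ := fun i => if i = 0 then (Units.mk0 _ h0)⁻¹ else 1
  refine ⟨b.unitsSMul w, ?_⟩
  have e : ⇑(b.unitsSMul w) = fun i => ((w i : Fˣ) : F) • b i := by
    ext i
    rw [Module.Basis.unitsSMul_apply]
    rfl
  rw [e, det.map_smul_univ, Fin.prod_univ_three]
  simp [w, h0]

/-- `slRankOne` as a bilinear map. -/
noncomputable def slRankOneLin : V →ₗ[F] Module.Dual F V →ₗ[F] sl F V :=
  LinearMap.mk₂ F (slRankOne hV h3)
    (fun x x' y => sl_ext fun w => by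
      simp only [coe_add_apply, coe_slRankOne_apply, map_add]; module)
    (fun t x y => sl_ext fun w => by
      simp only [coe_smul_apply, coe_slRankOne_apply, map_smul, smul_eq_mul]; module)
    (fun x x' y => sl_ext fun w => by
      simp only [coe_add_apply, coe_slRankOne_apply, LinearMap.add_apply]; module)
    (fun t x y => sl_ext fun w => by
      simp only [coe_smul_apply, coe_slRankOne_apply, LinearMap.smul_apply, smul_eq_mul]; module)

/-- `slForm` as a bilinear map. -/
noncomputable def slFormLin : sl F V →ₗ[F] sl F V →ₗ[F] F :=
  LinearMap.mk₂ F slForm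
    (fun x x' y => by simp [slForm, add_mul, mul_add])
    (fun t x y => by simp [slForm]; ring)
    (fun x x' y => by simp [slForm, mul_add])
    (fun t x y => by simp [slForm]; ring)

/-- `slCirc` as a bilinear map. -/
noncomputable def slCircLin : sl F V →ₗ[F] sl F V →ₗ[F] sl F V :=
  LinearMap.mk₂ F (slCirc hV h3)
    (fun x x' y => sl_ext fun w => by
      simp [slCirc, add_mul, mul_add]; module)
    (fun t x y => sl_ext fun w => by simp [slCirc]; module)
    (fun x x' y => sl_ext fun w => by simp [slCirc, add_mul, mul_add]; module)
    (fun t x y => sl_ext fun w => by simp [slCirc]; module)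

theorem trace_lie_invariant (x y z : Module.End F V) :
    LinearMap.trace F V ((z * x - x * z) * y) + LinearMap.trace F V (x * (z * y - y * z)) = 0 := by
  have h := LinearMap.trace_mul_comm F z (x * y)
  simp only [sub_mul, mul_sub, map_sub, ← mul_assoc] at h ⊢
  rw [h]
  ring

theorem slForm_invariant (x y z : sl F V) : slForm ⁅z, x⁆ y + slForm x ⁅z, y⁆ = 0 := by
  rw [slForm, slForm, ← mul_add]
  have h := trace_lie_invariant (x : Module.End F V) y z
  simp only [LieSubalgebra.coe_bracket, Ring.lie_def]
  rw [h, mul_zero]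

/-- Commutation with `z` is a derivation of the associative product, and the trace term is
invariant. Together with `slForm_invariant` this makes the right-hand side of the bracket formula
equivariant. -/
theorem lie_slCirc (x y z : sl F V) :
    ⁅z, slCirc hV h3 x y⁆ = slCirc hV h3 ⁅z, x⁆ y + slCirc hV h3 x ⁅z, y⁆ := by
  have h := trace_lie_invariant (x : Module.End F V) y z
  refine Subtype.ext ?_
  change _ = (slCirc hV h3 ⁅z, x⁆ y : Module.End F V) + (slCirc hV h3 x ⁅z, y⁆ : Module.End F V)
  rw [LieSubalgebra.coe_bracket]
  simp only [slCirc, LieSubalgebra.coe_bracket, Ring.lie_def]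
  rw [add_eq_zero_iff_eq_neg] at h
  rw [h, mul_sub, sub_mul]
  simp only [mul_smul_comm, smul_mul_assoc, mul_one, one_mul]
  rw [mul_neg, neg_smul]
  noncomm_ring

theorem slForm_slUnit (i j k l : Fin 3) (hij : i ≠ j) (hkl : k ≠ l) :
    slForm (E i j) (E k l) = if j = k ∧ i = l then 1 / 3 else 0 := by
  rw [slForm, LinearMap.trace_eq_matrix_trace F v, Matrix.trace]
  simp only [Matrix.diag_apply, LinearMap.toMatrix_apply, Module.End.mul_apply,
    coe_slUnit_apply_basis, if_neg hkl, sub_zero]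
  have : ∀ x, (v.repr ((E i j : Module.End F V) (if l = x then v k else 0))) x =
      if l = x then (if j = k ∧ i = l then 1 else 0) else 0 := by
    intro x
    rcases eq_or_ne l x with rfl | h1
    · rcases eq_or_ne j k with rfl | h2
      · simp [coe_slUnit_apply_basis, hij, Finsupp.single_apply]
      · simp [coe_slUnit_apply_basis, hij, h2]
    · simp [h1]
  simp only [this]
  simp

theorem slCirc_slUnit (i j k l : Fin 3) (hij : i ≠ j) (hkl : k ≠ l) :
    slCirc hV h3 (E i j) (E k l) =
      (if j = k then E i l else 0) + (if i = l then E k j else 0) := by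
  have hT := slForm_slUnit hV h3 v i j k l hij hkl
  rw [slForm] at hT
  have hT' : (2 / 3 : F) * LinearMap.trace F V ((E i j : Module.End F V) * (E k l)) =
      if j = k ∧ i = l then 2 / 3 else 0 := by
    have e : (2 / 3 : F) * LinearMap.trace F V ((E i j : Module.End F V) * (E k l)) =
        2 * ((1 / 3) * LinearMap.trace F V ((E i j : Module.End F V) * (E k l))) := by ring
    rw [e, hT]
    split_ifs <;> ring
  refine Subtype.ext (v.ext fun m => ?_)
  rw [coe_add_apply]
  change ((E i j : Module.End F V) * (E k l) + (E k l : Module.End F V) * (E i j) -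
    ((2 / 3 : F) * LinearMap.trace F V ((E i j : Module.End F V) * (E k l))) • 1) (v m) = _
  rw [hT']
  have e1 : ∀ i j k l : Fin 3, i ≠ j → (E i j : Module.End F V) (if l = m then v k else 0) =
      if j = k then (if l = m then v i else 0) else 0 := by
    intro i j k l hij
    by_cases h1 : l = m <;> simp [h1, coe_slUnit_apply_basis, hij]
  have e2 : ∀ (p : Prop) [Decidable p] (i l : Fin 3),
      ((if p then E i l else 0 : sl F V) : Module.End F V) (v m) =
        if p then (if l = m then v i else 0) - (if i = l then (1 / 3 : F) • v m else 0) else 0 := by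
    intro p _ i l
    by_cases h1 : p
    · rw [if_pos h1, if_pos h1, coe_slUnit_apply_basis]
    · rw [if_neg h1, if_neg h1, coe_zero_apply]
  simp only [LinearMap.add_apply, LinearMap.sub_apply, LinearMap.smul_apply, Module.End.mul_apply,
    Module.End.one_apply, coe_slUnit_apply_basis, if_neg hij, if_neg hkl, sub_zero, e1 _ _ _ _ hij,
    e1 _ _ _ _ hkl, e2]
  by_cases h1 : j = k <;> by_cases h2 : i = l <;>
    simp only [h1, h2, eq_comm, and_true, and_false, if_true, if_false,
      zero_smul, sub_zero, add_zero, zero_add]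
  all_goals module

end LinearAlgebra

/-! ### Bracket formulas for arbitrary vectors. -/

namespace Decomposition

variable {F : Type*} [Field F] {V : Type*} [AddCommGroup V] [Module F V]
  {L : Type*} [LieRing L] [LieAlgebra F L] {A B C : Type*} [AddCommGroup A] [Module F A]
  [AddCommGroup B] [Module F B] [AddCommGroup C] [Module F C]
  (D : Decomposition F V L A B C)
  (v : Module.Basis (Fin 3) F V) (hV : Module.finrank F V = 3) (h3 : (3 : F) ≠ 0)

local notation "E" => slUnit hV h3 v

/-- Equivariant bilinear maps on `𝔰𝔩(V)` that agree on pairs of root elements are equal. -/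
theorem bilin_ext {φ ψ : sl F V →ₗ[F] sl F V →ₗ[F] L}
    (hφ : ∀ z x y, ⁅D.ι z, φ x y⁆ = φ ⁅z, x⁆ y + φ x ⁅z, y⁆)
    (hψ : ∀ z x y, ⁅D.ι z, ψ x y⁆ = ψ ⁅z, x⁆ y + ψ x ⁅z, y⁆)
    (h : ∀ i j k l, i ≠ j → k ≠ l → φ (E i j) (E k l) = ψ (E i j) (E k l)) : φ = ψ := by
  have hroot : ∀ i j, i ≠ j → φ (E i j) = ψ (E i j) := by
    intro i j hij
    -- Equivariance moves `E k l` onto the first argument. The excluded case is the one in which its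
    -- bracket with `E i j` is diagonal and not yet covered.
    have hc : ∀ k l, k ≠ l → ¬ (l = i ∧ k = j) →
        φ (E i j) ⁅E k l, E l k⁆ = ψ (E i j) ⁅E k l, E l k⁆ := by
      intro k l hkl hn
      have e1 := hφ (E k l) (E i j) (E l k)
      have e2 := hψ (E k l) (E i j) (E l k)
      rw [h i j l k hij hkl.symm] at e1
      have e3 : φ ⁅E k l, E i j⁆ (E l k) = ψ ⁅E k l, E i j⁆ (E l k) := by
        rw [lie_slUnit]
        by_cases h1 : l = i
        · have h2 : k ≠ j := fun h2 => hn ⟨h1, h2⟩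
          rw [if_pos h1, if_neg h2, sub_zero, h k j l k h2 hkl.symm]
        · rw [if_neg h1]
          by_cases h2 : k = j
          · simp only [if_pos h2, map_sub, map_zero, LinearMap.sub_apply, LinearMap.zero_apply,
              h i l l k (Ne.symm h1) hkl.symm]
          · simp [h2]
      rw [e3] at e1
      exact add_left_cancel (e1.symm.trans e2)
    refine sl_hom_ext hV h3 v (fun k l hkl => h i j k l hij hkl) fun k l hkl => ?_
    by_cases hn : l = i ∧ k = j
    · obtain ⟨rfl, rfl⟩ := hn
      -- In the excluded case, interchanging `k` and `l` changes only the sign of the diagonal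
      -- element and leads back to an allowed pair.
      rw [← lie_skew, map_neg, map_neg, hc l k hkl.symm (by tauto)]
    · exact hc k l hkl hn
  refine sl_hom_ext hV h3 v hroot fun i j hij => LinearMap.ext fun y => ?_
  have e1 := hφ (E i j) (E j i) y
  have e2 := hψ (E i j) (E j i) y
  rw [hroot j i hij.symm] at e1
  exact add_right_cancel (e1.symm.trans e2)

/-- The coordinate maps obtained from a basis. -/
noncomputable def coordMaps (h2 : (2 : F) ≠ 0) : CoordMaps F A B C D.s where
  circ := D.mapAA v hV h3 + (D.mapAA v hV h3).flip
  comm := D.mapAA v hV h3 - (D.mapAA v hV h3).flip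
  derA := D.mapDAA v hV h3
  actB := D.mapAB v hV h3
  actC := D.mapCA v hV h3
  T := D.mapT v
  derBC := D.mapDBC v
  crossB := D.mapBB v
  crossC := D.mapCC v
  repA :=
    { D.mapSA v hV h3 with
      map_lie' := fun {d d'} => LinearMap.ext fun a => by
        refine D.inA_unit_injective v hV h3 0 1 (by decide) ?_
        change D.inA _ (D.mapSA v hV h3 ⁅d, d'⁆ a) = D.inA _
          (D.mapSA v hV h3 d (D.mapSA v hV h3 d' a) - D.mapSA v hV h3 d' (D.mapSA v hV h3 d a))
        simp only [inA_sub, ← D.lie_coe_inA v hV h3 h2, LieSubalgebra.coe_bracket, lie_lie] }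
  repB :=
    { D.mapSB v with
      map_lie' := fun {d d'} => LinearMap.ext fun b => by
        refine D.inB_basis_injective v 0 ?_
        change D.inB _ (D.mapSB v ⁅d, d'⁆ b) = D.inB _
          (D.mapSB v d (D.mapSB v d' b) - D.mapSB v d' (D.mapSB v d b))
        rw [← linB_apply, ← linB_apply, map_sub]
        simp only [linB_apply, ← D.lie_coe_inB v hV h3 h2, LieSubalgebra.coe_bracket, lie_lie] }
  repC :=
    { D.mapSC v with
      map_lie' := fun {d d'} => LinearMap.ext fun c => by
        refine D.inC_basis_injective v 0 ?_
        change D.inC _ (D.mapSC v ⁅d, d'⁆ c) = D.inC _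
          (D.mapSC v d (D.mapSC v d' c) - D.mapSC v d' (D.mapSC v d c))
        rw [← linC_apply, ← linC_apply, map_sub]
        simp only [linC_apply, ← D.lie_coe_inC v hV h3 h2, LieSubalgebra.coe_bracket, lie_lie] }

section Brackets

variable (h2 : (2 : F) ≠ 0)
include h2

/-- On root elements this is the basis computation. For an opposite bracket, `[E i j, E j i] ⊗ a` is
`ι (E i j)` applied to `E j i ⊗ a`, and Jacobi reduces to root elements. -/
theorem lie_inA_inB (x : sl F V) (u : V) (a : A) (b : B) :
    ⁅D.inA x a, D.inB u b⁆ = D.inB ((x : Module.End F V) u) (D.mapAB v hV h3 a b) := by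
  have key : lieBil (D.linA.flip a) (D.linB.flip b) LinearMap.id =
      (LinearMap.llcomp F V V L (D.linB.flip (D.mapAB v hV h3 a b))) ∘ₗ
        (sl F V).toSubmodule.subtype := by
    have hr : ∀ i j, i ≠ j → ∀ u,
        ⁅D.inA (E i j) a, D.inB u b⁆ =
          D.inB ((E i j : Module.End F V) u) (D.mapAB v hV h3 a b) := by
      intro i j hij u
      refine LinearMap.congr_fun (f := lieBil (D.linA.flip a) (D.linB.flip b) LinearMap.id (E i j))
        (g := D.linB.flip (D.mapAB v hV h3 a b) ∘ₗ (E i j : Module.End F V)) (v.ext fun k => ?_) u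
      simp only [lieBil_apply, LinearMap.flip_apply, LinearMap.id_apply, LinearMap.comp_apply,
        linA_apply, linB_apply, coe_slUnit_apply_basis, if_neg hij, sub_zero]
      by_cases hjk : j = k
      · subst hjk
        rw [if_pos rfl, D.lie_inA_inB_unit v hV h3 h2 i j hij]
      · rw [if_neg hjk, D.lie_inA_inB_of_ne v hV h3 h2 i j k hij hjk, zero_inB]
    refine sl_hom_ext hV h3 v (fun i j hij => LinearMap.ext fun u => hr i j hij u)
      fun i j hij => LinearMap.ext fun u => ?_
    change ⁅D.inA ⁅E i j, E j i⁆ a, D.inB u b⁆ =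
      D.inB (((⁅E i j, E j i⁆ : sl F V) : Module.End F V) u) (D.mapAB v hV h3 a b)
    rw [← lie_inA, lie_lie, lie_inB, hr j i hij.symm, hr j i hij.symm, lie_inB, coe_lie_apply,
      ← linB_apply, ← linB_apply, ← linB_apply, map_sub, LinearMap.sub_apply]
  exact LinearMap.congr_fun (LinearMap.congr_fun key x) u

theorem lie_inC_inA (f : Module.Dual F V) (x : sl F V) (c : C) (a : A) :
    ⁅D.inC f c, D.inA x a⁆ = D.inC (f ∘ₗ (x : Module.End F V)) (D.mapCA v hV h3 c a) := by
  have : Module.Finite F V := Module.Finite.of_basis v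
  have key : lieBil (D.linA.flip a) (D.linC.flip c) LinearMap.id =
      -((LinearMap.llcomp F (Module.Dual F V) (Module.Dual F V) L
        (D.linC.flip (D.mapCA v hV h3 c a))) ∘ₗ
          (LinearMap.llcomp F V V F).flip ∘ₗ (sl F V).toSubmodule.subtype) := by
    have hr : ∀ i j, i ≠ j → ∀ f,
        ⁅D.inA (E i j) a, D.inC f c⁆ =
          -D.inC (f ∘ₗ (E i j : Module.End F V)) (D.mapCA v hV h3 c a) := by
      intro i j hij f
      refine LinearMap.congr_fun (f := lieBil (D.linA.flip a) (D.linC.flip c) LinearMap.id (E i j))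
        (g := -(D.linC.flip (D.mapCA v hV h3 c a) ∘ₗ
          (LinearMap.llcomp F V V F).flip (E i j : Module.End F V)))
        (v.dualBasis.ext fun k => ?_) f
      rw [v.coe_dualBasis]
      change ⁅D.inA (E i j) a, D.inC (v.coord k) c⁆ =
        -D.inC (v.coord k ∘ₗ (E i j : Module.End F V)) (D.mapCA v hV h3 c a)
      rw [coord_comp_slUnit, if_neg hij, sub_zero, ← lie_skew]
      by_cases hik : i = k
      · subst hik
        rw [if_pos rfl, D.lie_inC_inA_unit v hV h3 h2 i j hij]
      · rw [if_neg hik, D.lie_inC_inA_of_ne v hV h3 h2 i j k hij hik, zero_inC]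
    refine sl_hom_ext hV h3 v (fun i j hij => LinearMap.ext fun f => hr i j hij f)
      fun i j hij => LinearMap.ext fun f => ?_
    change ⁅D.inA ⁅E i j, E j i⁆ a, D.inC f c⁆ =
      -D.inC (f ∘ₗ ((⁅E i j, E j i⁆ : sl F V) : Module.End F V)) (D.mapCA v hV h3 c a)
    have e : f ∘ₗ ((⁅E i j, E j i⁆ : sl F V) : Module.End F V) =
        (f ∘ₗ (E i j : Module.End F V)) ∘ₗ (E j i : Module.End F V) -
          (f ∘ₗ (E j i : Module.End F V)) ∘ₗ (E i j : Module.End F V) := by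
      refine LinearMap.ext fun w => ?_
      rw [LinearMap.comp_apply, coe_lie_apply, map_sub]
      rfl
    rw [← lie_inA, lie_lie, lie_inC, hr j i hij.symm, lie_neg, lie_neg, hr j i hij.symm, lie_inC, e,
      ← linC_apply, ← linC_apply, ← linC_apply, map_sub, LinearMap.sub_apply]
    abel
  have h := LinearMap.congr_fun (LinearMap.congr_fun key x) f
  rw [← lie_skew, neg_eq_iff_eq_neg]
  exact h

theorem lie_inB_inC (u : V) (f : Module.Dual F V) (b : B) (c : C) :
    ⁅D.inB u b, D.inC f c⁆ = D.inA (slRankOne hV h3 u f) (D.mapT v b c) +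
      ((1 / 3 : F) * f u) • (D.mapDBC v b c : L) := by
  have : Module.Finite F V := Module.Finite.of_basis v
  have key : lieBil (D.linB.flip b) (D.linC.flip c) LinearMap.id =
      (slRankOneLin hV h3).compr₂ (D.linA.flip (D.mapT v b c)) +
        (Module.Dual.eval F V).compr₂
          ((1 / 3 : F) • LinearMap.toSpanSingleton F L (D.mapDBC v b c : L)) := by
    refine v.ext fun i => v.dualBasis.ext fun j => ?_
    rw [v.coe_dualBasis]
    change ⁅D.inB (v i) b, D.inC (v.coord j) c⁆ = D.inA (E i j) (D.mapT v b c) +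
      (1 / 3 : F) • (v.coord j (v i) • (D.mapDBC v b c : L))
    by_cases hij : i = j
    · subst hij
      rw [D.lie_inB_inC_same v hV h3 h2]
      simp
    · rw [D.lie_inB_inC_unit v hV h3 h2 i j hij]
      simp [hij]
  have h := LinearMap.congr_fun (LinearMap.congr_fun key u) f
  refine h.trans ?_
  rw [mul_smul]
  rfl

include hV h3 in
theorem lie_inB_inB (det : V [⋀^Fin 3]→ₗ[F] F) (hv : det v = 1) (u u' : V) (b b' : B) :
    ⁅D.inB u b, D.inB u' b'⁆ = D.inC (wedge det u u') (D.mapBB v b b') := by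
  have key : lieBil (D.linB.flip b) (D.linB.flip b') LinearMap.id =
      (wedgeLin det).compr₂ (D.linC.flip (D.mapBB v b b')) := by
    refine v.ext fun i => v.ext fun j => ?_
    change ⁅D.inB (v i) b, D.inB (v j) b'⁆ = D.inC (wedge det (v i) (v j)) (D.mapBB v b b')
    have hj : ∀ i j : Fin 3, j = i ∨ j = i + 1 ∨ i = j + 1 := by decide
    rcases hj i j with rfl | rfl | rfl
    · rw [D.lie_inB_inB_same v hV h3 h2, wedge_self, zero_inC]
    · rw [D.lie_inB_inB_next v hV h3 h2, wedge_basis_next v det hv]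
    · rw [← lie_skew, D.lie_inB_inB_next v hV h3 h2, wedge_swap, wedge_basis_next v det hv, neg_inC,
        D.mapBB_symm v hV h3 h2]
  exact LinearMap.congr_fun (LinearMap.congr_fun key u) u'

include h3 in
theorem lie_inC_inC [Module.Finite F V] (det : V [⋀^Fin 3]→ₗ[F] F) (hv : det v = 1)
    (f f' : Module.Dual F V) (c c' : C) :
    ⁅D.inC f c, D.inC f' c'⁆ = D.inB (wedgeDual hV det f f') (D.mapCC v c c') := by
  have key : lieBil (D.linC.flip c) (D.linC.flip c') LinearMap.id =
      (wedgeDualLin hV det).compr₂ (D.linB.flip (D.mapCC v c c')) := by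
    refine v.dualBasis.ext fun i => v.dualBasis.ext fun j => ?_
    rw [v.coe_dualBasis]
    change ⁅D.inC (v.coord i) c, D.inC (v.coord j) c'⁆ =
      D.inB (wedgeDual hV det (v.coord i) (v.coord j)) (D.mapCC v c c')
    have hj : ∀ i j : Fin 3, j = i ∨ j = i + 1 ∨ i = j + 1 := by decide
    rcases hj i j with rfl | rfl | rfl
    · rw [D.lie_inC_inC_same v hV h3 h2, wedgeDual_self, zero_inB]
    · rw [D.lie_inC_inC_next v hV h3 h2, wedgeDual_coord_next hV v det hv]
    · rw [← lie_skew, D.lie_inC_inC_next v hV h3 h2, wedgeDual_swap,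
        wedgeDual_coord_next hV v det hv, neg_inB, D.mapCC_symm v hV h3 h2]
  exact LinearMap.congr_fun (LinearMap.congr_fun key f) f'

/-- Both sides are equivariant in `x, y`, so pairs of root elements suffice. Opposite, composable
(in either order) and unrelated pairs are the cases already computed. -/
theorem lie_inA_inA (x y : sl F V) (a a' : A) :
    ⁅D.inA x a, D.inA y a'⁆ =
      D.inA ⁅x, y⁆ ((1 / 2 : F) • (D.mapAA v hV h3 a a' + D.mapAA v hV h3 a' a)) +
        D.inA (slCirc hV h3 x y)
          ((1 / 2 : F) • (D.mapAA v hV h3 a a' - D.mapAA v hV h3 a' a)) +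
        slForm x y • (D.mapDAA v hV h3 a a' : L) := by
  set s : A := (1 / 2 : F) • (D.mapAA v hV h3 a a' + D.mapAA v hV h3 a' a) with hs
  set t : A := (1 / 2 : F) • (D.mapAA v hV h3 a a' - D.mapAA v hV h3 a' a) with ht
  set d := D.mapDAA v hV h3 a a' with hd
  have key : lieBil (D.linA.flip a) (D.linA.flip a') LinearMap.id =
      (LieModule.toEnd F (sl F V) (sl F V) : sl F V →ₗ[F] Module.End F (sl F V)).compr₂
          (D.linA.flip s) +
        (slCircLin hV h3).compr₂ (D.linA.flip t) +
        (slFormLin).compr₂ (LinearMap.toSpanSingleton F L (d : L)) := by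
    refine D.bilin_ext v hV h3 (fun z x y => ?_) (fun z x y => ?_) fun i j k l hij hkl => ?_
    · change ⁅D.ι z, ⁅D.inA x a, D.inA y a'⁆⁆ =
        ⁅D.inA ⁅z, x⁆ a, D.inA y a'⁆ + ⁅D.inA x a, D.inA ⁅z, y⁆ a'⁆
      rw [leibniz_lie, lie_inA, lie_inA]
    · change ⁅D.ι z, D.inA ⁅x, y⁆ s + D.inA (slCirc hV h3 x y) t + slForm x y • (d : L)⁆ =
        (D.inA ⁅⁅z, x⁆, y⁆ s + D.inA (slCirc hV h3 ⁅z, x⁆ y) t + slForm ⁅z, x⁆ y • (d : L)) +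
        (D.inA ⁅x, ⁅z, y⁆⁆ s + D.inA (slCirc hV h3 x ⁅z, y⁆) t + slForm x ⁅z, y⁆ • (d : L))
      rw [lie_add, lie_add, lie_smul, lie_coe, lie_inA, lie_inA, leibniz_lie, lie_slCirc, add_inA,
        add_inA, eq_neg_of_add_eq_zero_left (slForm_invariant x y z)]
      module
    · change ⁅D.inA (E i j) a, D.inA (E k l) a'⁆ =
        D.inA ⁅E i j, E k l⁆ s + D.inA (slCirc hV h3 (E i j) (E k l)) t +
          slForm (E i j) (E k l) • (d : L)
      rw [lie_slUnit, slCirc_slUnit hV h3 v i j k l hij hkl,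
        slForm_slUnit hV h3 v i j k l hij hkl, hs, ht, inA_half_add_half D h2]
      by_cases hjk : j = k
      · subst hjk
        by_cases hil : i = l
        · subst hil
          rw [D.lie_inA_inA_opp v hV h3 h2 i j hij]
          simp [hd]
        · rw [D.lie_inA_inA_unit v hV h3 h2 i j l hij hil hkl]
          simp [hil]
      · by_cases hil : i = l
        · subst hil
          rw [← lie_skew, D.lie_inA_inA_unit v hV h3 h2 k i j hkl (Ne.symm hjk) hij]
          simp [hjk]
        · rw [D.lie_inA_inA_of_ne v hV h3 h2 i j k l hij hkl hjk hil]
          simp [hil, hjk]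
  exact LinearMap.congr_fun (LinearMap.congr_fun key x) y

end Brackets

theorem isCoordinatizedBy_coordMaps [Module.Finite F V] (h2 : (2 : F) ≠ 0)
    (det : V [⋀^Fin 3]→ₗ[F] F) (hv : det v = 1) :
    IsCoordinatizedBy hV h3 det D (D.coordMaps v hV h3 h2) where
  circ_comm _ _ := add_comm _ _
  comm_anticomm _ _ := (neg_sub _ _).symm
  derA_skew := D.mapDAA_skew v hV h3 h2
  crossB_symm := D.mapBB_symm v hV h3 h2
  crossC_symm := D.mapCC_symm v hV h3 h2
  lie_A_A := D.lie_inA_inA v hV h3 h2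
  lie_A_B := D.lie_inA_inB v hV h3 h2
  lie_C_A := D.lie_inC_inA v hV h3 h2
  lie_B_C := D.lie_inB_inC v hV h3 h2
  lie_B_B := D.lie_inB_inB v hV h3 h2 det hv
  lie_C_C := D.lie_inC_inC v hV h3 h2 det hv
  lie_s_A := D.lie_coe_inA v hV h3 h2
  lie_s_B := D.lie_coe_inB v hV h3 h2
  lie_s_C := D.lie_coe_inC v hV h3 h2

end Decomposition

/-! ### Computation rules for the matrix algebra and the triple product. -/

namespace CoordMaps

variable {F A B C S : Type*} [Field F] [AddCommGroup A] [Module F A]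
  [AddCommGroup B] [Module F B] [AddCommGroup C] [Module F C] [LieRing S] [LieAlgebra F S]
  (m : CoordMaps F A B C S)

@[simp] theorem mulA_zero (a : A) : m.mulA a 0 = 0 := by simp [mulA]
@[simp] theorem zero_mulA (a : A) : m.mulA 0 a = 0 := by simp [mulA]
@[simp] theorem neg_mulA (a a' : A) : m.mulA (-a) a' = -m.mulA a a' := by
  simp only [mulA, map_neg, LinearMap.neg_apply]
  module
@[simp] theorem mulA_neg (a a' : A) : m.mulA a (-a') = -m.mulA a a' := by
  simp only [mulA, map_neg]
  module

theorem matMul_apply (a₁ a₂ a₁' a₂' : A) (b b' : B) (c c' : C) :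
    matMul m (a₁, c, b, a₂) (a₁', c', b', a₂') =
      (m.mulA a₁ a₁' - m.T b' c, m.actC c' a₁ + m.actC c a₂' + m.crossB b b',
        m.actB a₁' b + m.actB a₂ b' + m.crossC c c', m.mulA a₂' a₂ - m.T b c') := rfl

theorem matBar_apply (a₁ a₂ : A) (b : B) (c : C) :
    matBar F A B C (a₁, c, b, a₂) = (a₂, c, b, a₁) := rfl

end CoordMaps

section StructV

variable {F M : Type*} [Field F] [AddCommGroup M] [Module F M]
  (mul : M →ₗ[F] M →ₗ[F] M) (bar : M →ₗ[F] M) (x x' y y' z z' : M)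

theorem structV_add_left :
    structV mul bar (x + x') y z = structV mul bar x y z + structV mul bar x' y z := by
  simp only [structV, map_add, LinearMap.add_apply]
  abel

theorem structV_add_middle :
    structV mul bar x (y + y') z = structV mul bar x y z + structV mul bar x y' z := by
  simp only [structV, map_add, LinearMap.add_apply]
  abel

theorem structV_add_right :
    structV mul bar x y (z + z') = structV mul bar x y z + structV mul bar x y z' := by
  simp only [structV, map_add, LinearMap.add_apply]
  abel

end StructV

theorem matSpace_induction {A B C : Type*} [AddCommGroup A] [AddCommGroup B] [AddCommGroup C]
    {p : MatSpace A B C → Prop} (h : ∀ X Y, p X → p Y → p (X + Y)) (h₁ : ∀ a, p (a, 0, 0, 0))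
    (hc : ∀ c, p (0, c, 0, 0)) (hb : ∀ b, p (0, 0, b, 0)) (h₂ : ∀ a, p (0, 0, 0, a))
    (X : MatSpace A B C) : p X := by
  obtain ⟨a₁, c, b, a₂⟩ := X
  have e : ((a₁, c, b, a₂) : MatSpace A B C) =
      (a₁, 0, 0, 0) + ((0, c, 0, 0) + ((0, 0, b, 0) + (0, 0, 0, a₂))) := by
    simp
  rw [e]
  exact h _ _ (h₁ _) (h _ _ (hc _) (h _ _ (hb _) (h₂ _)))

/-! ### Identities among arbitrary coordinate maps, from the Jacobi identity. -/

namespace IsCoordinatizedBy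

variable {F : Type*} [Field F] {V : Type*} [AddCommGroup V] [Module F V] [Module.Finite F V]
  {L : Type*} [LieRing L] [LieAlgebra F L] {A B C : Type*} [AddCommGroup A] [Module F A]
  [AddCommGroup B] [Module F B] [AddCommGroup C] [Module F C]
  {D : Decomposition F V L A B C} {hV : Module.finrank F V = 3} {h3 : (3 : F) ≠ 0}
  {det : V [⋀^Fin 3]→ₗ[F] F} {m : CoordMaps F A B C D.s}
  (hm : IsCoordinatizedBy hV h3 det D m) (v : Module.Basis (Fin 3) F V)

local notation "E" => slUnit hV h3 v

section Rules

include hm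

/-- Opposite pairs are left out because they are exactly those for which `D_{a,a'}` contributes. -/
theorem lie_unit_unit (i j k l : Fin 3) (hij : i ≠ j) (hkl : k ≠ l) (h : ¬ (j = k ∧ i = l))
    (a a' : A) : ⁅D.inA (E i j) a, D.inA (E k l) a'⁆ =
      (if j = k then D.inA (E i l) (m.mulA a a') else 0) -
        (if i = l then D.inA (E k j) (m.mulA a' a) else 0) := by
  rw [hm.lie_A_A, lie_slUnit, slCirc_slUnit hV h3 v i j k l hij hkl,
    slForm_slUnit hV h3 v i j k l hij hkl, if_neg h, zero_smul, add_zero, CoordMaps.mulA,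
    CoordMaps.mulA, hm.circ_comm a', hm.comm_anticomm a']
  by_cases hjk : j = k
  · have hil : i ≠ l := fun e => h ⟨hjk, e⟩
    simp [hjk, hil, D.inA_add]
  · by_cases hil : i = l
    · simp [hjk, hil, D.inA_add, D.inA_neg, D.neg_inA]
      abel
    · simp [hjk, hil]

theorem lie_unit_basis (i j k : Fin 3) (hij : i ≠ j) (a : A) (b : B) :
    ⁅D.inA (E i j) a, D.inB (v k) b⁆ = if j = k then D.inB (v i) (m.actB a b) else 0 := by
  rw [hm.lie_A_B, coe_slUnit_apply_basis, if_neg hij, sub_zero]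
  split_ifs <;> simp

theorem lie_basis_unit (i j k : Fin 3) (hij : i ≠ j) (a : A) (b : B) :
    ⁅D.inB (v k) b, D.inA (E i j) a⁆ = if j = k then -D.inB (v i) (m.actB a b) else 0 := by
  rw [← lie_skew, hm.lie_unit_basis v i j k hij]
  split_ifs <;> simp

theorem lie_coord_unit (i j k : Fin 3) (hij : i ≠ j) (a : A) (c : C) :
    ⁅D.inC (v.coord k) c, D.inA (E i j) a⁆ =
      if i = k then D.inC (v.coord j) (m.actC c a) else 0 := by
  rw [hm.lie_C_A, coord_comp_slUnit, if_neg hij, sub_zero]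
  split_ifs <;> simp

theorem lie_unit_coord (i j k : Fin 3) (hij : i ≠ j) (a : A) (c : C) :
    ⁅D.inA (E i j) a, D.inC (v.coord k) c⁆ =
      if i = k then -D.inC (v.coord j) (m.actC c a) else 0 := by
  rw [← lie_skew, hm.lie_coord_unit v i j k hij]
  split_ifs <;> simp

theorem lie_basis_coord (i j : Fin 3) (hij : i ≠ j) (b : B) (c : C) :
    ⁅D.inB (v i) b, D.inC (v.coord j) c⁆ = D.inA (E i j) (m.T b c) := by
  rw [hm.lie_B_C, slUnit]
  simp [hij]

theorem lie_coord_basis (i j : Fin 3) (hij : i ≠ j) (b : B) (c : C) :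
    ⁅D.inC (v.coord j) c, D.inB (v i) b⁆ = -D.inA (E i j) (m.T b c) := by
  rw [← lie_skew, hm.lie_basis_coord v i j hij]

theorem lie_basis_basis (hv : det v = 1) (i j : Fin 3) (b b' : B) :
    ⁅D.inB (v i) b, D.inB (v j) b'⁆ =
      if j = i + 1 then D.inC (v.coord (i + 2)) (m.crossB b b')
      else if i = j + 1 then -D.inC (v.coord (j + 2)) (m.crossB b b') else 0 := by
  have hj : ∀ i j : Fin 3, j = i ∧ ¬ j = i + 1 ∧ ¬ i = j + 1 ∨ j = i + 1 ∨
      i = j + 1 ∧ ¬ j = i + 1 := by decide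
  rw [hm.lie_B_B]
  rcases hj i j with ⟨h1, h2, h3⟩ | h1 | ⟨h1, h2⟩
  · rw [if_neg h2, if_neg h3, h1, wedge_self, D.zero_inC]
  · rw [if_pos h1, h1, wedge_basis_next v det hv]
  · rw [if_neg h2, if_pos h1, h1, wedge_swap, wedge_basis_next v det hv, D.neg_inC]

theorem lie_coord_coord (hv : det v = 1) (i j : Fin 3) (c c' : C) :
    ⁅D.inC (v.coord i) c, D.inC (v.coord j) c'⁆ =
      if j = i + 1 then D.inB (v (i + 2)) (m.crossC c c')
      else if i = j + 1 then -D.inB (v (j + 2)) (m.crossC c c') else 0 := by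
  have hj : ∀ i j : Fin 3, j = i ∧ ¬ j = i + 1 ∧ ¬ i = j + 1 ∨ j = i + 1 ∨
      i = j + 1 ∧ ¬ j = i + 1 := by decide
  rw [hm.lie_C_C]
  rcases hj i j with ⟨h1, h2, h3⟩ | h1 | ⟨h1, h2⟩
  · rw [if_neg h2, if_neg h3, h1, wedgeDual_self, D.zero_inB]
  · rw [if_pos h1, h1, wedgeDual_coord_next hV v det hv]
  · rw [if_neg h2, if_pos h1, h1, wedgeDual_swap, wedgeDual_coord_next hV v det hv, D.neg_inB]

end Rules

section Identities

include hm v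

/-- This and the following compatibilities are Jacobi identities for three weight vectors whose
indices are chosen so that no opposite weights meet. Associativity of `A` is not among them: a chain
of three composable units would need a fourth index. -/
theorem actB_mulA (a a' : A) (b : B) : m.actB (m.mulA a a') b = m.actB a (m.actB a' b) := by
  have h := lie_lie (D.inA (E 0 1) a) (D.inA (E 1 2) a') (D.inB (v 2) b)
  simp [hm.lie_unit_unit v, hm.lie_unit_basis v] at h
  exact D.inB_basis_injective v 0 h

theorem actC_mulA (a a' : A) (c : C) : m.actC c (m.mulA a a') = m.actC (m.actC c a) a' := by
  have h := lie_lie (D.inA (E 0 1) a) (D.inA (E 1 2) a') (D.inC (v.coord 0) c)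
  simp [hm.lie_unit_unit v, hm.lie_unit_coord v] at h
  exact D.inC_basis_injective v 2 h

theorem T_actB (a : A) (b : B) (c : C) : m.T (m.actB a b) c = m.mulA a (m.T b c) := by
  have h := leibniz_lie (D.inA (E 0 1) a) (D.inB (v 1) b) (D.inC (v.coord 2) c)
  simp [hm.lie_unit_unit v, hm.lie_unit_coord v, hm.lie_unit_basis v, hm.lie_basis_coord v] at h
  exact (D.inA_unit_injective v hV h3 0 2 (by decide) h).symm

theorem T_actC (a : A) (b : B) (c : C) : m.T b (m.actC c a) = m.mulA (m.T b c) a := by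
  have h := leibniz_lie (D.inA (E 1 2) a) (D.inB (v 0) b) (D.inC (v.coord 1) c)
  simp [hm.lie_unit_unit v, hm.lie_unit_coord v, hm.lie_unit_basis v, hm.lie_basis_coord v] at h
  exact (D.inA_unit_injective v hV h3 0 2 (by decide) h).symm

theorem crossB_actB_left (hv : det v = 1) (a : A) (b b' : B) :
    m.crossB (m.actB a b) b' = m.actC (m.crossB b b') a := by
  have h := leibniz_lie (D.inA (E 0 1) a) (D.inB (v 1) b) (D.inB (v 2) b')
  simp [hm.lie_unit_coord v, hm.lie_unit_basis v, hm.lie_basis_basis v hv] at h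
  exact (D.inC_basis_injective v 1 h).symm

theorem crossB_actB_right (hv : det v = 1) (a : A) (b b' : B) :
    m.crossB b' (m.actB a b) = m.actC (m.crossB b' b) a := by
  rw [hm.crossB_symm, hm.crossB_actB_left v hv, hm.crossB_symm]

theorem crossC_actC_left (hv : det v = 1) (a : A) (c c' : C) :
    m.crossC (m.actC c a) c' = m.actB a (m.crossC c c') := by
  have h := leibniz_lie (D.inA (E 0 1) a) (D.inC (v.coord 0) c) (D.inC (v.coord 2) c')
  simp [hm.lie_unit_coord v, hm.lie_unit_basis v, hm.lie_coord_coord v hv] at h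
  exact (D.inB_basis_injective v 0 h).symm

theorem crossC_actC_right (hv : det v = 1) (a : A) (c c' : C) :
    m.crossC c' (m.actC c a) = m.actB a (m.crossC c' c) := by
  rw [hm.crossC_symm, hm.crossC_actC_left v hv, hm.crossC_symm]

/-- Two elements along `v 0` commute, so their adjoint actions on `v 1 ⊗ b''` can be interchanged.
With the symmetry of the cross product, `T (b, b' × b'')` is symmetric in all three arguments. -/
theorem T_crossB (hv : det v = 1) (b b' b'' : B) :
    m.T b (m.crossB b' b'') = m.T b' (m.crossB b b'') := by
  have h := leibniz_lie (D.inB (v 0) b) (D.inB (v 0) b') (D.inB (v 1) b'')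
  simp [hm.lie_basis_coord v, hm.lie_basis_basis v hv] at h
  exact D.inA_unit_injective v hV h3 0 2 (by decide) h

theorem T_crossC (hv : det v = 1) (c c' c'' : C) :
    m.T (m.crossC c' c'') c = m.T (m.crossC c c'') c' := by
  have h := leibniz_lie (D.inC (v.coord 0) c) (D.inC (v.coord 0) c') (D.inC (v.coord 1) c'')
  simp [hm.lie_coord_basis v, hm.lie_coord_coord v hv] at h
  exact D.inA_unit_injective v hV h3 2 0 (by decide) h

variable {one : A} (hone : ∀ x : sl F V, D.ι x = D.inA x one)
include hone

/-- The element `E 0 1 ⊗ 1` acts as the matrix unit itself. -/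
theorem one_mulA (a : A) : m.mulA one a = a := by
  have h := D.lie_unit_inA v hV h3 0 1 1 2 a
  rw [hone] at h
  simp [hm.lie_unit_unit v] at h
  exact D.inA_unit_injective v hV h3 0 2 (by decide) h

theorem mulA_one (a : A) : m.mulA a one = a := by
  have h := D.lie_unit_inA v hV h3 1 2 0 1 a
  rw [hone] at h
  simp [hm.lie_unit_unit v] at h
  exact D.inA_unit_injective v hV h3 0 2 (by decide) h

theorem one_actB (b : B) : m.actB one b = b := by
  have h := D.lie_unit_inB v hV h3 0 1 1 (by decide) b
  rw [hone] at h
  simp [hm.lie_unit_basis v] at h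
  exact D.inB_basis_injective v 0 h

theorem actC_one (c : C) : m.actC c one = c := by
  have h := D.lie_unit_inC v hV h3 0 1 0 (by decide) c
  rw [hone] at h
  simp [hm.lie_unit_coord v] at h
  exact D.inC_basis_injective v 1 h

end Identities

end IsCoordinatizedBy

/-! ### The parts of degree 1 and -1 with respect to `E 0 0 - E 2 2`. -/

namespace Decomposition

variable {F : Type*} [Field F] {V : Type*} [AddCommGroup V] [Module F V]
  {L : Type*} [LieRing L] [LieAlgebra F L] {A B C : Type*} [AddCommGroup A] [Module F A]
  [AddCommGroup B] [Module F B] [AddCommGroup C] [Module F C]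
  (D : Decomposition F V L A B C)
  (v : Module.Basis (Fin 3) F V) (hV : Module.finrank F V = 3) (h3 : (3 : F) ≠ 0)

local notation "E" => slUnit hV h3 v

/-- The matrix space as the positive short part of a `5`-grading of `L`. -/
noncomputable def posPart (X : MatSpace A B C) : L :=
  D.inA (E 0 1) X.1 + D.inC (v.coord 2) X.2.1 + D.inB (v 0) X.2.2.1 + D.inA (E 1 2) X.2.2.2

/-- The matrix space as the negative short part of a `5`-grading of `L`. -/
noncomputable def negPart (X : MatSpace A B C) : L :=
  D.inA (E 2 1) X.1 - D.inC (v.coord 0) X.2.1 - D.inB (v 2) X.2.2.1 + D.inA (E 1 0) X.2.2.2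

theorem inB_add (u : V) (b b' : B) : D.inB u (b + b') = D.inB u b + D.inB u b' :=
  map_add (D.linB u) b b'
theorem inB_sub (u : V) (b b' : B) : D.inB u (b - b') = D.inB u b - D.inB u b' :=
  map_sub (D.linB u) b b'
theorem inB_neg (u : V) (b : B) : D.inB u (-b) = -D.inB u b := map_neg (D.linB u) b
theorem inC_add (f : Module.Dual F V) (c c' : C) : D.inC f (c + c') = D.inC f c + D.inC f c' :=
  map_add (D.linC f) c c'
theorem inC_sub (f : Module.Dual F V) (c c' : C) : D.inC f (c - c') = D.inC f c - D.inC f c' :=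
  map_sub (D.linC f) c c'
theorem inC_neg (f : Module.Dual F V) (c : C) : D.inC f (-c) = -D.inC f c := map_neg (D.linC f) c

theorem posPart_add (X Y : MatSpace A B C) :
    D.posPart v hV h3 (X + Y) = D.posPart v hV h3 X + D.posPart v hV h3 Y := by
  simp only [posPart, Prod.fst_add, Prod.snd_add, inA_add, inB_add, inC_add]
  abel

theorem posPart_sub (X Y : MatSpace A B C) :
    D.posPart v hV h3 (X - Y) = D.posPart v hV h3 X - D.posPart v hV h3 Y := by
  simp only [posPart, Prod.fst_sub, Prod.snd_sub, inA_sub, inB_sub, inC_sub]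
  abel

theorem negPart_add (X Y : MatSpace A B C) :
    D.negPart v hV h3 (X + Y) = D.negPart v hV h3 X + D.negPart v hV h3 Y := by
  simp only [negPart, Prod.fst_add, Prod.snd_add, inA_add, inB_add, inC_add]
  abel

theorem posPart_injective : Function.Injective (D.posPart v hV h3) := by
  intro X Y h
  obtain ⟨a₁, c, b, a₂⟩ := X
  obtain ⟨a₁', c', b', a₂'⟩ := Y
  have h3' := congrArg (D.coordB v 0) h
  have h4 := congrArg (D.coordC v 2) h
  simp [posPart, coordB] at h3'
  simp [posPart, coordC] at h4
  subst h3' h4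
  have h5 : D.inA (E 0 1) a₁ + D.inA (E 1 2) a₂ = D.inA (E 0 1) a₁' + D.inA (E 1 2) a₂' := by
    simp only [posPart] at h
    rw [← sub_eq_zero] at h ⊢
    rw [← h]
    abel
  have h1 := congrArg (D.coordA v 0 1) h5
  have h2 := congrArg (D.coordA v 1 2) h5
  simp only [map_add, coordA_inA, coe_slUnit_apply_basis] at h1 h2
  simp at h1 h2
  rw [h1, h2]

end Decomposition

/-! ### Double brackets that start with an opposite pair. -/

namespace IsCoordinatizedBy

variable {F : Type*} [Field F] {V : Type*} [AddCommGroup V] [Module F V] [Module.Finite F V]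
  {L : Type*} [LieRing L] [LieAlgebra F L] {A B C : Type*} [AddCommGroup A] [Module F A]
  [AddCommGroup B] [Module F B] [AddCommGroup C] [Module F C]
  {D : Decomposition F V L A B C} {hV : Module.finrank F V = 3} {h3 : (3 : F) ≠ 0}
  {det : V [⋀^Fin 3]→ₗ[F] F} {m : CoordMaps F A B C D.s}
  (hm : IsCoordinatizedBy hV h3 det D m) (v : Module.Basis (Fin 3) F V)

local notation "E" => slUnit hV h3 v

section Opposite

variable {one : A} (hone : ∀ x : sl F V, D.ι x = D.inA x one)
include hm hone

/-- Expanding directly would meet the opposite pair again. Writing the third factor as the bracket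
of `E 0 2 ⊗ 1` and `E 2 1 ⊗ a''` and letting the inner bracket act as a derivation leaves only
brackets of non-opposite units. -/
theorem lie_lie_opp_fst (a a' a'' : A) :
    ⁅⁅D.inA (E 0 1) a, D.inA (E 1 0) a'⁆, D.inA (E 0 1) a''⁆ =
      D.inA (E 0 1) (m.mulA (m.mulA a a') a'' + m.mulA (m.mulA a'' a') a) := by
  have e : D.inA (E 0 1) a'' = ⁅D.inA (E 0 2) one, D.inA (E 2 1) a''⁆ := by
    simp [hm.lie_unit_unit v, hm.one_mulA v hone]
  rw [e, leibniz_lie, lie_lie (D.inA (E 0 1) a) (D.inA (E 1 0) a'),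
    lie_lie (D.inA (E 0 1) a) (D.inA (E 1 0) a')]
  simp [hm.lie_unit_unit v, hm.one_mulA v hone, hm.mulA_one v hone, D.inA_add]

theorem lie_lie_opp_snd (a a' a'' : A) :
    ⁅⁅D.inA (E 1 2) a, D.inA (E 2 1) a'⁆, D.inA (E 1 2) a''⁆ =
      D.inA (E 1 2) (m.mulA a'' (m.mulA a' a) + m.mulA a (m.mulA a' a'')) := by
  have e : D.inA (E 1 2) a'' = ⁅D.inA (E 1 0) a'', D.inA (E 0 2) one⁆ := by
    simp [hm.lie_unit_unit v, hm.mulA_one v hone]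
  rw [e, leibniz_lie, lie_lie (D.inA (E 1 2) a) (D.inA (E 2 1) a'),
    lie_lie (D.inA (E 1 2) a) (D.inA (E 2 1) a')]
  simp [hm.lie_unit_unit v, hm.one_mulA v hone, hm.mulA_one v hone, D.inA_add, add_comm]

/-- The same device avoids `D_{b,c}`: `v 0 ⊗ b'` is `E 0 1 ⊗ 1` applied to `v 1 ⊗ b'`. The cross
product term comes from the brackets within `V ⊗ B` and within `V* ⊗ C`. -/
theorem lie_lie_basis_coord (hv : det v = 1) (b b' : B) (c : C) :
    ⁅⁅D.inB (v 0) b, D.inC (v.coord 0) c⁆, D.inB (v 0) b'⁆ =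
      D.inB (v 0) (m.actB (m.T b c) b' + m.actB (m.T b' c) b + m.crossC c (m.crossB b b')) := by
  have e : D.inB (v 0) b' = ⁅D.inA (E 0 1) one, D.inB (v 1) b'⁆ := by
    simp [hm.lie_unit_basis v, hm.one_actB v hone]
  rw [e, leibniz_lie, lie_lie (D.inB (v 0) b) (D.inC (v.coord 0) c),
    lie_lie (D.inB (v 0) b) (D.inC (v.coord 0) c)]
  simp [hm.lie_unit_basis v, hm.lie_basis_unit v, hm.lie_coord_unit v, hm.lie_basis_coord v,
    hm.lie_coord_basis v, hm.lie_basis_basis v hv, hm.lie_coord_coord v hv,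
    hm.actC_one v hone, hm.one_actB v hone, D.inB_add]
  abel

theorem lie_lie_coord_basis (hv : det v = 1) (b : B) (c c' : C) :
    ⁅⁅D.inC (v.coord 2) c, D.inB (v 2) b⁆, D.inC (v.coord 2) c'⁆ =
      D.inC (v.coord 2)
        (m.actC c' (m.T b c) + m.actC c (m.T b c') + m.crossB b (m.crossC c c')) := by
  have e : D.inC (v.coord 2) c' = ⁅D.inC (v.coord 1) c', D.inA (E 1 2) one⁆ := by
    simp [hm.lie_coord_unit v, hm.actC_one v hone]
  rw [e, leibniz_lie, lie_lie (D.inC (v.coord 2) c) (D.inB (v 2) b),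
    lie_lie (D.inC (v.coord 2) c) (D.inB (v 2) b)]
  simp [hm.lie_unit_basis v, hm.lie_basis_unit v, hm.lie_coord_unit v, hm.lie_basis_coord v,
    hm.lie_coord_basis v, hm.lie_basis_basis v hv, hm.lie_coord_coord v hv, hm.lie_unit_coord v,
    hm.actC_one v hone, hm.one_actB v hone, D.inC_add]
  abel

end Opposite

end IsCoordinatizedBy

/-! ### The triple product as a double bracket. -/

namespace IsCoordinatizedBy

variable {F : Type*} [Field F] {V : Type*} [AddCommGroup V] [Module F V] [Module.Finite F V]
  {L : Type*} [LieRing L] [LieAlgebra F L] {A B C : Type*} [AddCommGroup A] [Module F A]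
  [AddCommGroup B] [Module F B] [AddCommGroup C] [Module F C]
  {D : Decomposition F V L A B C} {hV : Module.finrank F V = 3} {h3 : (3 : F) ≠ 0}
  {det : V [⋀^Fin 3]→ₗ[F] F} {m : CoordMaps F A B C D.s}
  (hm : IsCoordinatizedBy hV h3 det D m) (v : Module.Basis (Fin 3) F V)

local notation "E" => slUnit hV h3 v

variable {one : A} (hone : ∀ x : sl F V, D.ι x = D.inA x one)
include hm hone

set_option maxHeartbeats 2000000 in
/-- The double bracket of the `5`-grading is the triple product of the matrix space. -/
theorem lie_lie_posPart (hv : det v = 1) (X Y Z : MatSpace A B C) :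
    ⁅⁅D.posPart v hV h3 X, D.negPart v hV h3 Y⁆, D.posPart v hV h3 Z⁆ =
      D.posPart v hV h3 (structV (matMul m) (matBar F A B C) X Y Z) := by
  -- Both sides are additive in each of `X`, `Y`, `Z`, so each may be taken with a single nonzero
  -- entry, which leaves 64 cases.
  induction X using matSpace_induction with
  | h X X' hX hX' =>
    rw [structV_add_left, D.posPart_add, D.posPart_add, add_lie, add_lie, hX, hX']
  | _ x =>
    induction Y using matSpace_induction with
    | h Y Y' hY hY' =>
      rw [structV_add_middle, D.posPart_add, D.negPart_add, lie_add, add_lie, hY, hY']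
    | _ y =>
      induction Z using matSpace_induction with
      | h Z Z' hZ hZ' =>
        rw [structV_add_right, D.posPart_add, D.posPart_add, lie_add, hZ, hZ']
      | _ z =>
        -- The four double bracket lemmas settle the cases where `X` and `Y` have opposite weights
        -- and `Z` has the weight of `X`. In all other cases Jacobi meets only brackets without a
        -- component in `𝔰`.
        simp only [Decomposition.posPart, Decomposition.negPart, structV, CoordMaps.matMul_apply,
          CoordMaps.matBar_apply, Decomposition.inA_zero, Decomposition.inB_zero,
          Decomposition.inC_zero, add_zero, zero_add, sub_zero, zero_sub, map_zero,
          LinearMap.zero_apply, CoordMaps.mulA_zero, CoordMaps.zero_mulA, Prod.mk_add_mk,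
          Prod.mk_sub_mk, map_neg, LinearMap.neg_apply, CoordMaps.mulA_neg, CoordMaps.neg_mulA,
          lie_neg, neg_lie, Decomposition.inA_neg, Decomposition.inB_neg, Decomposition.inC_neg,
          sub_self, neg_neg, neg_zero, hm.lie_lie_opp_fst v hone, hm.lie_lie_opp_snd v hone,
          hm.lie_lie_basis_coord v hone hv, hm.lie_lie_coord_basis v hone hv]
        try simp [hm.lie_unit_unit v, hm.lie_unit_basis v, hm.lie_basis_unit v,
          hm.lie_coord_unit v, hm.lie_basis_coord v, hm.lie_coord_basis v,
          hm.lie_basis_basis v hv, hm.lie_coord_coord v hv, hm.lie_unit_coord v]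
        try simp only [hm.actB_mulA v, hm.actC_mulA v, hm.T_actB v, hm.T_actC v,
          hm.crossB_actB_left v hv, hm.crossB_actB_right v hv, hm.crossC_actC_left v hv,
          hm.crossC_actC_right v hv, hm.crossB_symm, hm.crossC_symm, hm.T_crossB v hv,
          hm.T_crossC v hv, Decomposition.inA_add, Decomposition.inB_add, Decomposition.inC_add,
          Decomposition.inA_sub, Decomposition.inB_sub, Decomposition.inC_sub,
          Decomposition.inA_neg, Decomposition.inB_neg, Decomposition.inC_neg, sub_self,
          add_sub_cancel_right, sub_neg_eq_add, neg_add_cancel, add_zero, zero_add,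
          Decomposition.inA_zero, Decomposition.inB_zero, Decomposition.inC_zero]
        try abel

end IsCoordinatizedBy

/-! ### Reversal of the basis. -/

section OppositeBasis

variable {F : Type*} [Field F] {V : Type*} [AddCommGroup V] [Module F V]
  (v : Module.Basis (Fin 3) F V)

/-- The basis `(v 2, -v 1, v 0)`. -/
noncomputable def oppBasis : Module.Basis (Fin 3) F V :=
  (v.reindex (Equiv.swap 0 2)).unitsSMul ![1, -1, 1]

theorem oppBasis_zero : oppBasis v 0 = v 2 := by
  simp [oppBasis, Module.Basis.unitsSMul_apply]

theorem oppBasis_one : oppBasis v 1 = -v 1 := by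
  simp [oppBasis, Module.Basis.unitsSMul_apply, Equiv.swap_apply_of_ne_of_ne]

theorem oppBasis_two : oppBasis v 2 = v 0 := by
  simp [oppBasis, Module.Basis.unitsSMul_apply]

theorem coord_oppBasis_zero : (oppBasis v).coord 0 = v.coord 2 := by
  rw [oppBasis, Module.Basis.coord_unitsSMul]
  refine LinearMap.ext fun w => ?_
  simp

theorem coord_oppBasis_one : (oppBasis v).coord 1 = -v.coord 1 := by
  rw [oppBasis, Module.Basis.coord_unitsSMul]
  refine LinearMap.ext fun w => ?_
  simp [Equiv.swap_apply_of_ne_of_ne]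

theorem coord_oppBasis_two : (oppBasis v).coord 2 = v.coord 0 := by
  rw [oppBasis, Module.Basis.coord_unitsSMul]
  refine LinearMap.ext fun w => ?_
  simp

/-- The sign of the transposition is cancelled by the sign put on `v 1`. -/
theorem det_oppBasis (det : V [⋀^Fin 3]→ₗ[F] F) : det (oppBasis v) = det v := by
  have e : ⇑(oppBasis v) = fun i => (![1, -1, 1] : Fin 3 → F) i • (v ∘ Equiv.swap 0 2) i := by
    ext i
    fin_cases i
    · simpa using oppBasis_zero v
    · simpa [Equiv.swap_apply_of_ne_of_ne] using oppBasis_one v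
    · simpa using oppBasis_two v
  rw [e, det.map_smul_univ, det.map_perm, Fin.prod_univ_three]
  simp [Equiv.Perm.sign_swap]

end OppositeBasis

namespace Decomposition

variable {F : Type*} [Field F] {V : Type*} [AddCommGroup V] [Module F V]
  {L : Type*} [LieRing L] [LieAlgebra F L] {A B C : Type*} [AddCommGroup A] [Module F A]
  [AddCommGroup B] [Module F B] [AddCommGroup C] [Module F C]
  (D : Decomposition F V L A B C)
  (v : Module.Basis (Fin 3) F V) (hV : Module.finrank F V = 3) (h3 : (3 : F) ≠ 0)

theorem inA_slRankOne_neg_left (u : V) (f : Module.Dual F V) (a : A) :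
    D.inA (slRankOne hV h3 (-u) f) a = -D.inA (slRankOne hV h3 u f) a := by
  rw [← neg_inA]
  exact congrArg (D.inA · a) (LinearMap.congr_fun (map_neg (slRankOneLin hV h3) u) f)

theorem inA_slRankOne_neg_right (u : V) (f : Module.Dual F V) (a : A) :
    D.inA (slRankOne hV h3 u (-f)) a = -D.inA (slRankOne hV h3 u f) a := by
  rw [← neg_inA]
  exact congrArg (D.inA · a) (map_neg (slRankOneLin hV h3 u) f)

/-- Reversing the order of the basis exchanges degrees 1 and -1. The sign on `v 1` affects only the
two `A` entries, and the signs in `negPart` are chosen so that a common factor -1 remains. -/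
theorem posPart_oppBasis (X : MatSpace A B C) :
    D.posPart (oppBasis v) hV h3 X = -D.negPart v hV h3 X := by
  simp only [posPart, negPart, slUnit, oppBasis_zero, oppBasis_one, coord_oppBasis_one,
    coord_oppBasis_two, inA_slRankOne_neg_left, inA_slRankOne_neg_right]
  abel

theorem negPart_oppBasis (X : MatSpace A B C) :
    D.negPart (oppBasis v) hV h3 X = -D.posPart v hV h3 X := by
  simp only [posPart, negPart, slUnit, oppBasis_two, oppBasis_one, coord_oppBasis_one,
    coord_oppBasis_zero, inA_slRankOne_neg_left, inA_slRankOne_neg_right]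
  abel

end Decomposition

/-! ### The structurable identity. -/

namespace IsCoordinatizedBy

variable {F : Type*} [Field F] {V : Type*} [AddCommGroup V] [Module F V] [Module.Finite F V]
  {L : Type*} [LieRing L] [LieAlgebra F L] {A B C : Type*} [AddCommGroup A] [Module F A]
  [AddCommGroup B] [Module F B] [AddCommGroup C] [Module F C]
  {D : Decomposition F V L A B C} {hV : Module.finrank F V = 3} {h3 : (3 : F) ≠ 0}
  {det : V [⋀^Fin 3]→ₗ[F] F} {m : CoordMaps F A B C D.s}
  (hm : IsCoordinatizedBy hV h3 det D m) (v : Module.Basis (Fin 3) F V)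
  {one : A} (hone : ∀ x : sl F V, D.ι x = D.inA x one)
include hm hone

/-- This is `lie_lie_posPart` for the reversed basis, with the roles of `X` and `Y` exchanged; the
sign comes from turning the inner bracket around. -/
theorem lie_lie_negPart (hv : det v = 1) (X Y Z : MatSpace A B C) :
    ⁅⁅D.posPart v hV h3 X, D.negPart v hV h3 Y⁆, D.negPart v hV h3 Z⁆ =
      -D.negPart v hV h3 (structV (matMul m) (matBar F A B C) Y X Z) := by
  have h := hm.lie_lie_posPart (oppBasis v) hone ((det_oppBasis v det).trans hv) Y X Z
  simp only [D.posPart_oppBasis, D.negPart_oppBasis, neg_lie, lie_neg, neg_neg] at h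
  rw [← h, ← neg_lie, lie_skew]

theorem isStructurable (hv : det v = 1) :
    IsStructurable (matMul m) (matBar F A B C) (one, 0, 0, one) where
  one_mul := by
    rintro ⟨a₁, c, b, a₂⟩
    simp [CoordMaps.matMul_apply, hm.one_mulA v hone, hm.mulA_one v hone, hm.one_actB v hone,
      hm.actC_one v hone]
  mul_one := by
    rintro ⟨a₁, c, b, a₂⟩
    simp [CoordMaps.matMul_apply, hm.one_mulA v hone, hm.mulA_one v hone, hm.one_actB v hone,
      hm.actC_one v hone]
  bar_bar := fun _ => rfl
  bar_mul := by
    rintro ⟨a₁, c, b, a₂⟩ ⟨a₁', c', b', a₂'⟩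
    simp only [CoordMaps.matMul_apply, CoordMaps.matBar_apply, hm.crossB_symm b' b,
      hm.crossC_symm c' c, add_comm (m.actC c' a₁), add_comm (m.actB a₁' b)]
  lie_structV X Y Z W T := by
    refine D.posPart_injective v hV h3 ?_
    rw [D.posPart_sub, D.posPart_sub]
    simp only [← hm.lie_lie_posPart v hone hv]
    -- The left side is the bracket of `[X⁺, Y⁻]` and `[Z⁺, W⁻]` applied to `T⁺`. Letting `[X⁺, Y⁻]`
    -- act as a derivation on `[Z⁺, W⁻]` gives the two terms on the right, the minus sign coming
    -- from `lie_lie_negPart`.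
    rw [← lie_lie, leibniz_lie ⁅D.posPart v hV h3 X, _⁆ (D.posPart v hV h3 Z),
      hm.lie_lie_posPart v hone hv X Y Z, hm.lie_lie_negPart v hone hv X Y W, lie_neg, add_lie,
      neg_lie, sub_eq_add_neg]

end IsCoordinatizedBy

end Sl3Lie

theorem theorem3 {F : Type*} [Field F] (h2 : (2 : F) ≠ 0) (h3 : (3 : F) ≠ 0)
    {V : Type*} [AddCommGroup V] [Module F V] [Module.Finite F V]
    (hV : Module.finrank F V = 3)
    (det : V [⋀^Fin 3]→ₗ[F] F) (hdet : det ≠ 0)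
    {L : Type*} [LieRing L] [LieAlgebra F L]
    {A B C : Type*} [AddCommGroup A] [Module F A] [AddCommGroup B] [Module F B]
    [AddCommGroup C] [Module F C]
    (D : Sl3Lie.Decomposition F V L A B C) :
    ∃ one : A, (∀ x : Sl3Lie.sl F V, D.ι x = D.inA x one) ∧
      (∃ m : Sl3Lie.CoordMaps F A B C D.s, Sl3Lie.IsCoordinatizedBy hV h3 det D m) ∧
      ∀ m : Sl3Lie.CoordMaps F A B C D.s, Sl3Lie.IsCoordinatizedBy hV h3 det D m →
        Sl3Lie.IsStructurable (Sl3Lie.matMul m) (Sl3Lie.matBar F A B C) (one, 0, 0, one) := by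
  obtain ⟨v, hv⟩ := Sl3Lie.exists_basis_det_eq_one hV det hdet
  obtain ⟨one, hone⟩ := D.exists_one v hV h3 h2
  exact ⟨one, hone, ⟨_, D.isCoordinatizedBy_coordMaps v hV h3 h2 det hv⟩,
    fun m hm => hm.isStructurable v hone hv⟩
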